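/- **Setting.** Let $k_0$ be a commutative ring and $k$ a field over $k_0$. A *quasi-separable formal monoid* $M$ over $k_0$ is a filtered system $(\operatorname{Spec} E_{0,i})_{i\in I}$ ($I$ a small filtered category) of finite flat quasi-separable $k_0$-schemes (every fibre over a field $K$ is $\operatorname{Spec}$ of a finite $K$-algebra whose reduction is separable over $K$), together with a monoid structure on the ind-scheme $\varinjlim_i\operatorname{Spec}E_{0,i}$. Put $E_i=k\otimes_{k_0}E_{0,i}$; write $i$ for the unit and $m$ for the product of $M$. Let $C$ be a small rigid abelian $k$-linear symmetric tensor category with finite-dimensional $\operatorname{Hom}$-spaces, objects of finite length and $\operatorname{End}(\mathbf 1)=k$. For a finite $k$-algebra $F$, an $F$-module in $C$ is an object with an action of $F$; it is *$F$-injective* if its dual is flat over $F$; for $F'\to F$ and an $F'$-module $X$ put $\varphi^!X=\operatorname{Hom}_{F'}(F,X)$. The tensor product $X\otimes^F Y$ is the largest subobject of $X\otimes Y$ on which the two actions of $F$ agree, with unit $F^\vee$. The *prolongation* $\operatorname{Plng}(E)$ of $C$ is the category of systems $(X_i)_{i\in I}$ of $E_i$-injective modules in $C$ with compatible isomorphisms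 $X_i=\operatorname{Hom}_{E_j}(E_i,X_j)$ for $i\to j$, with the levelwise tensor product $\otimes^E$. An *$E$-tensor category* is such a $C$ with an *$E$-structure* $(\tau,a,b)$: an exact $k_0$-linear tensor functor $\tau=(\tau_i)\colon C\to\operatorname{Plng}(E)$ and isomorphisms of tensor functors $a\colon i^!\tau\cong\mathrm{Id}$ ($k$-linear) and $b\colon\tau\tau\cong m^!\tau$ ($E\otimes E$-linear). They induce natural maps $a_X\colon X\to\tau X$ and $\mu_X\colon\tau\tau X\to m^!\tau X\to\tau X$, where $\tau X$ also denotes the ind-object $\varinjlim_i\tau_iX$, and $\tau$ is extended to $\operatorname{Ind}(C)$ by filtered colimits. The $E$-structure is *coherent* if $a,b$ are compatible with the unit and associativity laws of the monoid $M$, i.e. $\mu_X\circ a_{\tau X}=\mathrm{id}=\mu_X\circ\tau(a_X)$ and $\mu_X\circ\tau(\mu_X)=\mu_X\circ\mu_{\tau X}$ for all $X$. An *algebra in $C$* is a commutative algebra object $W$ of $\operatorname{Ind}(C)$; affine schemes in $C$ form the opposite category. For algebras $W,B$ in $C$, $\tau W$ is an algebra for $\otimes^E$, and $t\colon\tau W\to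 B$ in $\operatorname{Ind}(C)$ is called an *algebra map* if $\tau W\otimes^E\tau W\to\tau W\xrightarrow{t}B$ is the restriction of $\tau W\otimes\tau W\xrightarrow{t\otimes t}B\otimes B\to B$, and $E^\vee=\tau\mathbf 1\to\tau W\xrightarrow{t}B$ is evaluation at $1$, $E^\vee\to\mathbf 1$, followed by the unit of $B$. An *$E$-structure on an algebra* $X$ in $C$ is an algebra map $d\colon\tau X\to X$ with $d\circ a_X=\mathrm{id}$ and $d\circ\tau(d)=d\circ\mu_X$. *Affine $M$-schemes in $C$* form the opposite of the category of algebras in $C$ with $E$-structure (and algebra maps commuting with $d$). **Proposition.** Let $(C,\tau,a,b)$ be an $E$-tensor category. 1. The forgetful functor from affine $M$-schemes in $C$ to affine schemes in $C$ has a right adjoint $R$. 2. If $(\tau,a,b)$ is coherent, $R$ is given by $W\mapsto\tau W$, in the following sense: for every algebra $W$ in $C$, let $(R(W),d)$ be the algebra with $E$-structure that corresponds to $R(\operatorname{Spec}W)$, and $\varepsilon\colon W\to R(W)$ the algebra map given by the counit; then $t=d\circ\tau(\varepsilon)\colon\tau W\to R(W)$ is an algebra map, and it is the universal one: every algebra map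 from $\tau W$ to an algebra $B$ in $C$ factors as $g\circ t$ for a unique morphism of algebras $g\colon R(W)\to B$. 3. For every object $X$ of $C$ there is an affine space in $C$, i.e. an algebra $A$ in $C$ with a morphism $s\colon X^\vee\to A$ through which every morphism from $X^\vee$ to an algebra in $C$ factors by a unique morphism of algebras; and $R(\operatorname{Spec}A)$ is the affine space $M$-scheme $A(X)$: for every algebra $B$ with $E$-structure and every morphism $f\colon X^\vee\to B$ in $\operatorname{Ind}(C)$ there is a unique morphism $g\colon R(A)\to B$ of algebras with $E$-structure such that $g\circ\varepsilon\circ s=f$. -/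

import Mathlib

open CategoryTheory CategoryTheory.Limits CategoryTheory.MonoidalCategory Opposite
open scoped TensorProduct

universe u w

noncomputable section

/-! ### Formal monoids -/

/-- A commutative algebra over a field is quasi-separable if it is finite and its associated
reduced algebra is separable (a finite commutative algebra over a field is separable
iff it is étale). -/
def IsQuasiSeparableAlg (K A : Type w) [Field K] [CommRing A] [Algebra K A] : Prop :=
  Module.Finite K A ∧ Algebra.Etale K (A ⧸ nilradical A)

/-- `Spec A → Spec k₀` is quasi-separable: all its fibres are. -/
def IsQuasiSeparableMap (k₀ A : Type w) [CommRing k₀] [CommRing A] [Algebra k₀ A] : Prop :=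
  ∀ (K : Type w) [Field K] [Algebra k₀ K], IsQuasiSeparableAlg K (K ⊗[k₀] A)

/-- A quasi-separable formal set over `k₀`: an ind-object `(Spec E i)` of finite flat
quasi-separable schemes, given by a filtered category `I` and a contravariant system of algebras. -/
structure FormalSet (k₀ : Type w) [CommRing k₀] where
  I : Type u
  [cat : SmallCategory I]
  [filt : IsFiltered I]
  E : Iᵒᵖ ⥤ CommAlgCat.{w} k₀
  finite : ∀ i, Module.Finite k₀ (E.obj i)
  flat : ∀ i, Module.Flat k₀ (E.obj i)
  quasiSep : ∀ i, IsQuasiSeparableMap k₀ (E.obj i)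

namespace FormalSet

attribute [instance] FormalSet.cat FormalSet.filt

variable {k₀ : Type w} [CommRing k₀] (M : FormalSet.{u} k₀)

/-- The `i`-th algebra of the system. -/
abbrev E₀ (i : M.I) : Type w := M.E.obj (op i)

/-- The transition map `E₀ j → E₀ i` attached to `i ⟶ j`. -/
def res {i j : M.I} (t : i ⟶ j) : M.E₀ j →ₐ[k₀] M.E₀ i := (M.E.map t.op).hom

/-- Representatives of `R`-points: maps of `k₀`-algebras `E₀ l → R`. -/
def PreResPt (R : Type w) [CommRing R] [Algebra k₀ R] : Type (max u w) :=
  Σ l : M.I, (M.E₀ l →ₐ[k₀] R)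

/-- Two representatives agree if they agree after composition with transition maps. -/
def PtRel (R : Type w) [CommRing R] [Algebra k₀ R] (p q : M.PreResPt R) : Prop :=
  ∃ (n : M.I) (s : p.1 ⟶ n) (t : q.1 ⟶ n), p.2.comp (M.res s) = q.2.comp (M.res t)

/-- The set `colim_l Hom(E₀ l, R)` of `R`-points of the ind-scheme `colim_l Spec (E₀ l)`, i.e. the
set of maps of pro-algebras from `(E₀ l)` to `R`. -/
def Pt (R : Type w) [CommRing R] [Algebra k₀ R] : Type (max u w) := Quot (M.PtRel R)

/-- The `R`-point represented by `f : E₀ l → R`. -/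
def pt {R : Type w} [CommRing R] [Algebra k₀ R] {l : M.I} (f : M.E₀ l →ₐ[k₀] R) : M.Pt R :=
  Quot.mk _ ⟨l, f⟩

/-- Functoriality of points. -/
def mapPt {R S : Type w} [CommRing R] [Algebra k₀ R] [CommRing S] [Algebra k₀ S]
    (φ : R →ₐ[k₀] S) : M.Pt R → M.Pt S :=
  Quot.map (fun p => ⟨p.1, φ.comp p.2⟩) (by
    rintro ⟨l, f⟩ ⟨l', f'⟩ ⟨n, s, t, h⟩
    refine ⟨n, s, t, ?_⟩
    simp only [AlgHom.comp_assoc] at h ⊢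
    rw [h])

end FormalSet

/-- A quasi-separable formal monoid over `k₀`: a monoid object in formal sets, i.e. (by Yoneda) a
monoid structure on the sets of points `M(R)`, natural in the commutative `k₀`-algebra `R`. -/
structure FormalMonoid (k₀ : Type w) [CommRing k₀] extends FormalSet.{u} k₀ where
  mon : ∀ (R : Type w) [CommRing R] [Algebra k₀ R], Monoid (toFormalSet.Pt R)
  mapPt_one : ∀ {R S : Type w} [CommRing R] [Algebra k₀ R] [CommRing S] [Algebra k₀ S]
    (φ : R →ₐ[k₀] S), toFormalSet.mapPt φ 1 = 1
  mapPt_mul : ∀ {R S : Type w} [CommRing R] [Algebra k₀ R] [CommRing S] [Algebra k₀ S]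
    (φ : R →ₐ[k₀] S) (x y : toFormalSet.Pt R),
      toFormalSet.mapPt φ (x * y) = toFormalSet.mapPt φ x * toFormalSet.mapPt φ y

namespace FormalMonoid

variable {k₀ : Type w} [CommRing k₀] (M : FormalMonoid.{u} k₀)

instance (R : Type w) [CommRing R] [Algebra k₀ R] : Monoid (M.Pt R) := M.mon R

/-- `g : E₀ l → k₀` represents the base point, the unit of the monoid. -/
def IsBase {l : M.I} (g : M.E₀ l →ₐ[k₀] k₀) : Prop := M.pt g = 1

/-- `f : E₀ l → E₀ i ⊗ E₀ j` represents the component at `(i, j)` of the product of the monoid.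
Here `E₀ i` belongs to the second factor of the product `x * y` and `E₀ j` to the first:
for a left action, the function `z ↦ φ (x * y • z)` is obtained from `φ`
by acting first through `x` and then through `y`. -/
def IsProd {i j l : M.I} (f : M.E₀ l →ₐ[k₀] (M.E₀ i ⊗[k₀] M.E₀ j)) : Prop :=
  M.pt f =
    M.pt (Algebra.TensorProduct.includeRight : M.E₀ j →ₐ[k₀] (M.E₀ i ⊗[k₀] M.E₀ j)) *
    M.pt (Algebra.TensorProduct.includeLeft : M.E₀ i →ₐ[k₀] (M.E₀ i ⊗[k₀] M.E₀ j))

end FormalMonoid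

/-! ### Tensor categories and modules in them -/

/-- The standing assumptions on a rigid abelian `k`-linear tensor category besides those that are
carried by the type classes: finite-dimensional `Hom`-spaces, objects of finite length, and
`End 𝟙 = k`. -/
structure IsTensorCat (k : Type w) [Field k] (C : Type u) [SmallCategory C] [Abelian C]
    [Linear k C] [MonoidalCategory C] : Prop where
  finite_hom : ∀ X Y : C, Module.Finite k (X ⟶ Y)
  finite_length : ∀ X : C, ∃ n : ℕ, ∀ s : LTSeries (Subobject X), s.length ≤ n
  unit : Function.Bijective (algebraMap k (End (𝟙_ C)))

section Modules

variable {k : Type w} [Field k] {C : Type u} [SmallCategory C] [Abelian C] [Linear k C]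

/-- An `F`-module in `C` is an object `X` with an algebra map `F →ₐ[k] End X`.
For `φ : F' → F`, an `F`-module `Y` and an `F'`-module `X`, a morphism
`Y ⟶ X` is linear over `φ` if it is a map of `F'`-modules. -/
def IsLinOver {F F' : Type w} [CommRing F] [Algebra k F] [CommRing F'] [Algebra k F']
    (φ : F' →ₐ[k] F) {Y X : C} (ρ : F →ₐ[k] End Y) (σ : F' →ₐ[k] End X) (c : Y ⟶ X) : Prop :=
  ∀ e : F', (ρ (φ e) : Y ⟶ Y) ≫ c = c ≫ (σ e : X ⟶ X)

/-- The `F`-module `Y` is `φ^! X = Hom_{F'}(F, X)`, with evaluation at `1` given by `c : Y ⟶ X`: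
`c` is universal among `F'`-linear maps from `F`-modules to `X`. -/
def IsCoind {F F' : Type w} [CommRing F] [Algebra k F] [CommRing F'] [Algebra k F']
    (φ : F' →ₐ[k] F) {Y X : C} (ρ : F →ₐ[k] End Y) (σ : F' →ₐ[k] End X) (c : Y ⟶ X) : Prop :=
  IsLinOver φ ρ σ c ∧
  ∀ (Z : C) (θ : F →ₐ[k] End Z) (h : Z ⟶ X), IsLinOver φ θ σ h →
    ∃! g : Z ⟶ Y, IsLinOver (AlgHom.id k F) θ ρ g ∧ g ≫ c = h

/-- `F`-linearity of an additive map from an `F`-module to `Hom(X, Y)`, for `X` an `F`-module. -/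
def IsHomLin {F : Type w} [CommRing F] [Algebra k F] {X : C} (ρ : F →ₐ[k] End X)
    (N : Type w) [AddCommGroup N] [Module F N] {Y : C} (v : N →+ (X ⟶ Y)) : Prop :=
  ∀ (e : F) (n : N), v (e • n) = (ρ e : X ⟶ X) ≫ v n

/-- `t : N → Hom(X, T)` exhibits `T` as `N ⊗_F X`, i.e. `N ↦ N ⊗_F X` is left adjoint to
`Y ↦ Hom(X, Y)`. -/
def IsModTensor {F : Type w} [CommRing F] [Algebra k F] {X : C} (ρ : F →ₐ[k] End X)
    (N : Type w) [AddCommGroup N] [Module F N] {T : C} (t : N →+ (X ⟶ T)) : Prop :=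
  IsHomLin ρ N t ∧
  ∀ (Y : C) (v : N →+ (X ⟶ Y)), IsHomLin ρ N v → ∃! g : T ⟶ Y, ∀ n, t n ≫ g = v n

/-- The `F`-module `X` in `C` is flat: the (right exact) functor `N ↦ N ⊗_F X` on finitely
generated `F`-modules takes injective maps to monomorphisms. -/
def IsFlatMod {F : Type w} [CommRing F] [Algebra k F] {X : C} (ρ : F →ₐ[k] End X) : Prop :=
  ∀ (N N' : Type w) [AddCommGroup N] [Module F N] [AddCommGroup N'] [Module F N']
    [Module.Finite F N] [Module.Finite F N'] (f : N →ₗ[F] N'), Function.Injective f →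
    ∀ (T T' : C) (t : N →+ (X ⟶ T)) (t' : N' →+ (X ⟶ T')), IsModTensor ρ N t →
      IsModTensor ρ N' t' → ∀ g : T ⟶ T', (∀ n, t n ≫ g = t' (f n)) → Mono g

/-- `d : P ⟶ X ⊗ Y` exhibits the `F`-module `P` as the dual tensor product `X ⊗^F Y`, the largest
subobject of `X ⊗ Y` on which the two actions of `F` agree, with the induced action. -/
def IsDualTensor [MonoidalCategory C] {F : Type w} [CommRing F] [Algebra k F] {P X Y : C}
    (π : F →ₐ[k] End P) (ρ : F →ₐ[k] End X) (σ : F →ₐ[k] End Y) (d : P ⟶ X ⊗ Y) : Prop :=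
  (∀ e : F, (π e : P ⟶ P) ≫ d = d ≫ (ρ e : X ⟶ X) ▷ Y) ∧
  (∀ e : F, (π e : P ⟶ P) ≫ d = d ≫ X ◁ (σ e : Y ⟶ Y)) ∧
  ∀ (Z : C) (h : Z ⟶ X ⊗ Y), (∀ e : F, h ≫ (ρ e : X ⟶ X) ▷ Y = h ≫ X ◁ (σ e : Y ⟶ Y)) →
    ∃! g : Z ⟶ P, g ≫ d = h

section Dual

variable [MonoidalCategory C] [MonoidalPreadditive C] [MonoidalLinear k C] [RigidCategory C]

theorem rightAdjointMate_add_aux {X : C} (f g : X ⟶ X) :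
    rightAdjointMate (f + g) = rightAdjointMate f + rightAdjointMate g := by
  simp [rightAdjointMate]

/-- The dual `F`-module: `e` acts on the dual object by the transpose of its action. -/
def dualAct {F : Type w} [CommRing F] [Algebra k F] {X : C} (ρ : F →ₐ[k] End X) :
    F →ₐ[k] End (Xᘁ) where
  toFun e := ((ρ e : X ⟶ X)ᘁ : Xᘁ ⟶ Xᘁ)
  map_one' := by rw [map_one]; exact rightAdjointMate_id
  map_mul' a b := by
    rw [mul_comm a b, map_mul]
    exact comp_rightAdjointMate
  map_zero' := by
    rw [map_zero]
    change rightAdjointMate (0 : X ⟶ X) = 0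
    simp [rightAdjointMate]
  map_add' a b := by
    rw [map_add]
    exact rightAdjointMate_add_aux _ _
  commutes' r := by
    rw [AlgHom.commutes, Algebra.algebraMap_eq_smul_one, Algebra.algebraMap_eq_smul_one]
    change rightAdjointMate (r • 𝟙 X) = r • 𝟙 (Xᘁ)
    rw [← rightAdjointMate_id]
    simp [rightAdjointMate]

/-- The `F`-module `X` is `F`-injective: its dual is `F`-flat. -/
def IsInjMod {F : Type w} [CommRing F] [Algebra k F] {X : C} (ρ : F →ₐ[k] End X) : Prop :=
  IsFlatMod (dualAct ρ)

end Dual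

end Modules

/-! ### Prolongations of a tensor category -/

section Prolongation

variable {k₀ : Type w} [CommRing k₀] (M : FormalMonoid.{u} k₀)
  (k : Type w) [Field k] [Algebra k₀ k]

/-- The finite `k`-algebra `E i = k ⊗ E₀ i`. -/
abbrev FormalMonoid.Ek (i : M.I) : Type w := k ⊗[k₀] M.E₀ i

/-- Base change to `k` of a map of `k₀`-algebras. -/
def baseChangeHom {A B : Type w} [CommRing A] [Algebra k₀ A] [CommRing B] [Algebra k₀ B]
    (f : A →ₐ[k₀] B) : (k ⊗[k₀] A) →ₐ[k] (k ⊗[k₀] B) :=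
  Algebra.TensorProduct.map (AlgHom.id k k) f

/-- The map `k ⊗ A → k` induced by a `k₀`-point `A → k₀`. -/
def basePointHom {A : Type w} [CommRing A] [Algebra k₀ A]
    (g : A →ₐ[k₀] k₀) : (k ⊗[k₀] A) →ₐ[k] k :=
  Algebra.TensorProduct.lift (AlgHom.id k k) ((Algebra.ofId k₀ k).comp g) fun _ _ => Commute.all _ _

variable (C : Type u) [SmallCategory C] [Abelian C] [Linear k C] [MonoidalCategory C]
  [MonoidalPreadditive C] [MonoidalLinear k C] [RigidCategory C]

/-- An object of the `E`-prolongation of `C`: a compatible system of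
`E i`-injective modules `X i`, with `X i = Hom_{E j}(E i, X j)` for each `i ⟶ j`. The system is
recorded through the evaluation maps `X i ⟶ X j`. -/
structure Plng where
  sys : M.I ⥤ C
  act : ∀ i, M.Ek k i →ₐ[k] End (sys.obj i)
  cart : ∀ {i j : M.I} (t : i ⟶ j),
    IsCoind (baseChangeHom k (M.res t)) (act i) (act j) (sys.map t)
  inj : ∀ i, IsInjMod (act i)

/-- Morphisms of the prolongation: compatible systems of `E i`-linear maps. -/
@[ext]
structure Plng.Hom (X Y : Plng M k C) where
  nat : X.sys ⟶ Y.sys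
  lin : ∀ i, IsLinOver (AlgHom.id k (M.Ek k i)) (X.act i) (Y.act i) (nat.app i)

instance : Category (Plng M k C) where
  Hom X Y := Plng.Hom M k C X Y
  id X := ⟨𝟙 X.sys, fun i e => by simp⟩
  comp f g := ⟨f.nat ≫ g.nat, fun i e => by
    have hf := f.lin i e
    have hg := g.lin i e
    simp only [AlgHom.id_apply] at hf hg
    simp only [AlgHom.id_apply, NatTrans.comp_app]
    rw [← Category.assoc, hf, Category.assoc, hg, Category.assoc]⟩
  id_comp f := by apply Plng.Hom.ext; exact Category.id_comp _
  comp_id f := by apply Plng.Hom.ext; exact Category.comp_id _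
  assoc f g h := by apply Plng.Hom.ext; exact Category.assoc _ _ _

/-- The underlying system of objects of `C`. -/
def Plng.toSys : Plng M k C ⥤ (M.I ⥤ C) where
  obj X := X.sys
  map f := f.nat

/-- The underlying object at level `i`. -/
abbrev Plng.ev (i : M.I) : Plng M k C ⥤ C := Plng.toSys M k C ⋙ (evaluation M.I C).obj i

end Prolongation

/-! ### `E`-structures -/

section EStructure

variable {k₀ : Type w} [CommRing k₀] (M : FormalMonoid.{u} k₀)
  (k : Type w) [Field k] [Algebra k₀ k]
  (C : Type u) [SmallCategory C] [Abelian C] [Linear k C] [MonoidalCategory C]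
  [MonoidalPreadditive C] [MonoidalLinear k C] [RigidCategory C]

/-- A `k₀`-linear functor from `C` to its prolongation which is exact, i.e. each
component `C ⥤ (E i-modules)` is exact. -/
structure ProlongationFunctor where
  τ : C ⥤ Plng M k C
  additive : ∀ i, (τ ⋙ Plng.ev M k C i).Additive
  map_smul : ∀ (i) {X Y : C} (c : k₀) (f : X ⟶ Y),
    (τ ⋙ Plng.ev M k C i).map (algebraMap k₀ k c • f) =
      algebraMap k₀ k c • (τ ⋙ Plng.ev M k C i).map f
  left_exact : ∀ i, PreservesFiniteLimits (τ ⋙ Plng.ev M k C i)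
  right_exact : ∀ i, PreservesFiniteColimits (τ ⋙ Plng.ev M k C i)

namespace ProlongationFunctor

variable {M k C} (S : ProlongationFunctor M k C)

/-- The component `X ↦ τ_i X`, as a functor to `C`. -/
abbrev T (i : M.I) : C ⥤ C := S.τ ⋙ Plng.ev M k C i

/-- The `E i`-action on `τ_i X`. -/
def act (i : M.I) (X : C) : M.Ek k i →ₐ[k] End ((S.T i).obj X) := (S.τ.obj X).act i

/-- The transition map `τ_i X ⟶ τ_j X`, natural in `X`. -/
def trans {i j : M.I} (t : i ⟶ j) : S.T i ⟶ S.T j where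
  app X := (S.τ.obj X).sys.map t
  naturality _ _ f := ((S.τ.map f).nat.naturality t).symm

/-- The action of `E₀ i` on the `E i`-module `τ_i X`. -/
def outerAct (i : M.I) (X : C) : M.E₀ i →+* End ((S.T i).obj X) :=
  (S.act i X).toRingHom.comp
    (Algebra.TensorProduct.includeRight : M.E₀ i →ₐ[k₀] (k ⊗[k₀] M.E₀ i)).toRingHom

theorem outerAct_algebraMap (i : M.I) (X : C) (r : k₀) :
    S.outerAct i X (algebraMap k₀ _ r) = algebraMap k (End _) (algebraMap k₀ k r) := by
  change S.act i X (1 ⊗ₜ[k₀] algebraMap k₀ (M.E₀ i) r) = _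
  rw [← AlgHom.commutes (S.act i X), Algebra.TensorProduct.algebraMap_apply,
    Algebra.algebraMap_self_apply, Algebra.algebraMap_eq_smul_one r, ← TensorProduct.smul_tmul,
    Algebra.algebraMap_eq_smul_one r]

/-- The action of `E₀ j` on `τ_i τ_j X` obtained by applying `τ_i` to its action on `τ_j X`. -/
def innerAct (i j : M.I) (X : C) : M.E₀ j →+* End ((S.T i).obj ((S.T j).obj X)) where
  toFun e := (S.T i).map (S.outerAct j X e)
  map_one' := by rw [map_one]; exact (S.T i).map_id _
  map_mul' a b := by rw [map_mul]; exact (S.T i).map_comp _ _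
  map_zero' := by
    have := S.additive i
    rw [map_zero]; exact (S.T i).map_zero _ _
  map_add' a b := by
    have := S.additive i
    rw [map_add]; exact (S.T i).map_add

theorem innerAct_algebraMap (i j : M.I) (X : C) (r : k₀) :
    S.innerAct i j X (algebraMap k₀ _ r) = algebraMap k (End _) (algebraMap k₀ k r) := by
  change (S.T i).map (S.outerAct j X (algebraMap k₀ _ r)) = _
  rw [outerAct_algebraMap, Algebra.algebraMap_eq_smul_one (algebraMap k₀ k r),
    Algebra.algebraMap_eq_smul_one (algebraMap k₀ k r)]
  refine (S.map_smul i r (𝟙 _)).trans ?_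
  exact congrArg _ ((S.T i).map_id _)

/-- The action of `E i ⊗ E j = k ⊗ (E₀ i ⊗ E₀ j)` on `τ_i τ_j X`: `E i` acts through the module
structure of `τ_i (τ_j X)`, and `E₀ j` through its action on `τ_j X`. -/
def act₂ (i j : M.I) (X : C) :
    (k ⊗[k₀] (M.E₀ i ⊗[k₀] M.E₀ j)) →ₐ[k] End ((S.T i).obj ((S.T j).obj X)) :=
  letI : Algebra k₀ (End ((S.T i).obj ((S.T j).obj X))) :=
    Algebra.compHom _ (algebraMap k₀ k)
  haveI : IsScalarTower k₀ k (End ((S.T i).obj ((S.T j).obj X))) :=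
    IsScalarTower.of_algebraMap_eq fun _ => rfl
  Algebra.TensorProduct.lift (Algebra.ofId k _)
    (Algebra.TensorProduct.lift
      { S.outerAct i ((S.T j).obj X) with commutes' := S.outerAct_algebraMap i _ }
      { S.innerAct i j X with commutes' := S.innerAct_algebraMap i j X }
      fun e e' => ((S.τ.map (S.outerAct j X e')).lin i (1 ⊗ₜ[k₀] e)).symm)
    fun c _ => Algebra.commutes c _

end ProlongationFunctor

variable [SymmetricCategory C]

open Functor.OplaxMonoidal in
/-- An exact `k₀`-linear tensor functor `τ` from `C` to its prolongation.

A tensor structure on `τ` consists of isomorphisms `τ (X ⊗ Y) = τ X ⊗^E τ Y` and `τ 𝟙 = E^∨`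
compatible with the constraints. As `⊗^E` is a subobject of `⊗`,
it is recorded by the comparison maps `δ : τ_i (X ⊗ Y) ⟶ τ_i X ⊗ τ_i Y` and `η : τ_i 𝟙 ⟶ 𝟙`,
which form a symmetric oplax monoidal structure compatible with the transition maps, and are
required to be the inclusion of the dual tensor product and the evaluation at `1` of the
dual `E^∨ = Hom_k(E i, 𝟙)`. -/
structure TensorProlongationFunctor extends ProlongationFunctor M k C where
  oplax : ∀ i, (toProlongationFunctor.T i).OplaxMonoidal
  δ_braiding : ∀ (i) (X Y : C),
    δ (toProlongationFunctor.T i) X Y ≫ (β_ _ _).hom =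
      (toProlongationFunctor.T i).map (β_ X Y).hom ≫ δ (toProlongationFunctor.T i) Y X
  δ_trans : ∀ {i j : M.I} (t : i ⟶ j) (X Y : C),
    (toProlongationFunctor.trans t).app (X ⊗ Y) ≫ δ (toProlongationFunctor.T j) X Y =
      δ (toProlongationFunctor.T i) X Y ≫
        ((toProlongationFunctor.trans t).app X ⊗ₘ (toProlongationFunctor.trans t).app Y)
  η_trans : ∀ {i j : M.I} (t : i ⟶ j),
    (toProlongationFunctor.trans t).app (𝟙_ C) ≫ η (toProlongationFunctor.T j) =
      η (toProlongationFunctor.T i)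
  δ_dual : ∀ (i) (X Y : C), IsDualTensor (toProlongationFunctor.act i (X ⊗ Y))
    (toProlongationFunctor.act i X) (toProlongationFunctor.act i Y)
    (δ (toProlongationFunctor.T i) X Y)
  η_dual : ∀ i, IsCoind (Algebra.ofId k (M.Ek k i)) (toProlongationFunctor.act i (𝟙_ C))
    (Algebra.ofId k (End (𝟙_ C))) (η (toProlongationFunctor.T i))

attribute [instance] TensorProlongationFunctor.oplax

open Functor.OplaxMonoidal in
/-- An `E₀`-structure on `C`: a tensor functor `τ` to the prolongation together with tensor
isomorphisms `i^! τ → Id` and `τ τ → m^! τ`, the first `k`-linear, the second `E ⊗ E`-linear.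

The isomorphism `i^! τ X = X` is recorded by the resulting map `a : X = Hom_{E l}(k, τ_l X) ⟶ τ_l X`
for each representative `g : E₀ l → k₀` of the base point, and `τ τ X = m^! τ X` by the
maps `b : τ_i τ_j X = Hom_{E l}(E i ⊗ E j, τ_l X) ⟶ τ_l X` (evaluation at `1`) for each
representative `f : E₀ l → E₀ i ⊗ E₀ j` of the product. They are natural in `X`, compatible with
the transition maps and with the tensor structures. -/
structure EStructure extends TensorProlongationFunctor M k C where
  a : ∀ {l : M.I} (g : M.E₀ l →ₐ[k₀] k₀), M.IsBase g → (𝟭 C ⟶ toProlongationFunctor.T l)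
  a_coind : ∀ {l : M.I} (g : M.E₀ l →ₐ[k₀] k₀) (hg : M.IsBase g) (X : C),
    IsCoind (basePointHom k g) (Algebra.ofId k (End X)) (toProlongationFunctor.act l X)
      ((a g hg).app X)
  a_trans : ∀ {l l' : M.I} (t : l ⟶ l') (g : M.E₀ l →ₐ[k₀] k₀) (g' : M.E₀ l' →ₐ[k₀] k₀)
    (hg : M.IsBase g) (hg' : M.IsBase g'), g' = g.comp (M.res t) →
    a g hg ≫ toProlongationFunctor.trans t = a g' hg'
  a_tensor : ∀ {l : M.I} (g : M.E₀ l →ₐ[k₀] k₀) (hg : M.IsBase g) (X Y : C),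
    (a g hg).app (X ⊗ Y) ≫ δ (toProlongationFunctor.T l) X Y =
      ((a g hg).app X ⊗ₘ (a g hg).app Y)
  a_unit : ∀ {l : M.I} (g : M.E₀ l →ₐ[k₀] k₀) (hg : M.IsBase g),
    (a g hg).app (𝟙_ C) ≫ η (toProlongationFunctor.T l) = 𝟙 _
  b : ∀ {i j l : M.I} (f : M.E₀ l →ₐ[k₀] (M.E₀ i ⊗[k₀] M.E₀ j)), M.IsProd f →
    (toProlongationFunctor.T j ⋙ toProlongationFunctor.T i ⟶ toProlongationFunctor.T l)
  b_coind : ∀ {i j l : M.I} (f : M.E₀ l →ₐ[k₀] (M.E₀ i ⊗[k₀] M.E₀ j)) (hf : M.IsProd f) (X : C),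
    IsCoind (baseChangeHom k f) (toProlongationFunctor.act₂ i j X) (toProlongationFunctor.act l X)
      ((b f hf).app X)
  b_trans : ∀ {i i' j j' l l' : M.I} (r : i ⟶ i') (s : j ⟶ j') (t : l ⟶ l')
    (f : M.E₀ l →ₐ[k₀] (M.E₀ i ⊗[k₀] M.E₀ j)) (f' : M.E₀ l' →ₐ[k₀] (M.E₀ i' ⊗[k₀] M.E₀ j'))
    (hf : M.IsProd f) (hf' : M.IsProd f'),
    (Algebra.TensorProduct.map (M.res r) (M.res s)).comp f' = f.comp (M.res t) → ∀ X : C,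
    (b f hf).app X ≫ (toProlongationFunctor.trans t).app X =
      (toProlongationFunctor.T i).map ((toProlongationFunctor.trans s).app X) ≫
        (toProlongationFunctor.trans r).app ((toProlongationFunctor.T j').obj X) ≫
          (b f' hf').app X
  b_tensor : ∀ {i j l : M.I} (f : M.E₀ l →ₐ[k₀] (M.E₀ i ⊗[k₀] M.E₀ j)) (hf : M.IsProd f) (X Y : C),
    (b f hf).app (X ⊗ Y) ≫ δ (toProlongationFunctor.T l) X Y =
      (toProlongationFunctor.T i).map (δ (toProlongationFunctor.T j) X Y) ≫
        δ (toProlongationFunctor.T i) _ _ ≫ ((b f hf).app X ⊗ₘ (b f hf).app Y)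
  b_unit : ∀ {i j l : M.I} (f : M.E₀ l →ₐ[k₀] (M.E₀ i ⊗[k₀] M.E₀ j)) (hf : M.IsProd f),
    (b f hf).app (𝟙_ C) ≫ η (toProlongationFunctor.T l) =
      (toProlongationFunctor.T i).map (η (toProlongationFunctor.T j)) ≫
        η (toProlongationFunctor.T i)

end EStructure

/-! ### Algebras in `Ind C` -/

section IndObjects

variable (C : Type u) [SmallCategory C] [Abelian C] [MonoidalCategory C]

/-- The tensor product of ind-objects, `(colim X_p) ⊗ (colim Y_q) = colim (X_p ⊗ Y_q)`: the
extension of the tensor product of `C` by filtered colimits. -/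
def indTensor : Ind C × Ind C ⥤ Ind C :=
  (Functor.prod (Ind.yoneda (C := C)) (Ind.yoneda (C := C))).pointwiseLeftKanExtension
    (tensor C ⋙ Ind.yoneda)

variable {C}

/-- The tensor product `A ⊗ B ⟶ X ⊗ Y` of morphisms `A ⟶ X` and `B ⟶ Y` from objects of `C` to
ind-objects. -/
def indTensorHom {A B : C} {X Y : Ind C} (x : Ind.yoneda.obj A ⟶ X) (y : Ind.yoneda.obj B ⟶ Y) :
    Ind.yoneda.obj (A ⊗ B) ⟶ (indTensor C).obj (X, Y) :=
  ((Functor.prod (Ind.yoneda (C := C)) (Ind.yoneda (C := C))).pointwiseLeftKanExtensionUnit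
    (tensor C ⋙ Ind.yoneda)).app (A, B) ≫
      (indTensor C).map ((x, y) : (Ind.yoneda.obj A, Ind.yoneda.obj B) ⟶ (X, Y))

variable (C) [SymmetricCategory C]

/-- A commutative algebra in `C`: an ind-object `X` with morphisms `X ⊗ X ⟶ X` and `𝟙 ⟶ X` which
are associative, unital and commutative. As ind-objects are filtered colimits
of objects of `C`, the axioms are checked on morphisms `A ⟶ X` with `A` in `C`. -/
structure IndAlg where
  X : Ind C
  mul : (indTensor C).obj (X, X) ⟶ X
  one : Ind.yoneda.obj (𝟙_ C) ⟶ X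
  assoc : ∀ {A₁ A₂ A₃ : C} (x : Ind.yoneda.obj A₁ ⟶ X) (y : Ind.yoneda.obj A₂ ⟶ X)
    (z : Ind.yoneda.obj A₃ ⟶ X),
    indTensorHom (indTensorHom x y ≫ mul) z ≫ mul =
      Ind.yoneda.map (α_ A₁ A₂ A₃).hom ≫ indTensorHom x (indTensorHom y z ≫ mul) ≫ mul
  one_mul : ∀ {A : C} (x : Ind.yoneda.obj A ⟶ X),
    indTensorHom one x ≫ mul = Ind.yoneda.map (λ_ A).hom ≫ x
  comm : ∀ {A B : C} (x : Ind.yoneda.obj A ⟶ X) (y : Ind.yoneda.obj B ⟶ X),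
    indTensorHom x y ≫ mul = Ind.yoneda.map (β_ A B).hom ≫ indTensorHom y x ≫ mul

namespace IndAlg

variable {C}

/-- Morphisms of algebras. -/
@[ext]
structure Hom (X Y : IndAlg C) where
  hom : X.X ⟶ Y.X
  map_mul : X.mul ≫ hom =
    (indTensor C).map ((hom, hom) : (X.X, X.X) ⟶ (Y.X, Y.X)) ≫ Y.mul
  map_one : X.one ≫ hom = Y.one

instance : Category (IndAlg C) where
  Hom := Hom
  id X := ⟨𝟙 X.X, by
    rw [Category.comp_id]
    exact ((congrArg (· ≫ X.mul) ((indTensor C).map_id (X.X, X.X))).trans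
      (Category.id_comp _)).symm, by simp⟩
  comp {X Y Z} f g := ⟨f.hom ≫ g.hom, by
    rw [← Category.assoc, f.map_mul, Category.assoc, g.map_mul, ← Category.assoc,
      ← Functor.map_comp]
    rfl, by rw [← Category.assoc, f.map_one, g.map_one]⟩
  id_comp f := by apply Hom.ext; exact Category.id_comp _
  comp_id f := by apply Hom.ext; exact Category.comp_id _
  assoc f g h := by apply Hom.ext; exact Category.assoc _ _ _

/-- The product `A ⊗ B ⟶ X` of `A ⟶ X` and `B ⟶ X`. -/
def pmul (X : IndAlg C) {A B : C} (x : Ind.yoneda.obj A ⟶ X.X) (y : Ind.yoneda.obj B ⟶ X.X) :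
    Ind.yoneda.obj (A ⊗ B) ⟶ X.X :=
  indTensorHom x y ≫ X.mul

end IndAlg

end IndObjects

/-! ### `M`-schemes in `C` -/

section MSchemes

variable {k₀ : Type w} [CommRing k₀] {M : FormalMonoid.{u} k₀}
  {k : Type w} [Field k] [Algebra k₀ k]
  {C : Type u} [SmallCategory C] [Abelian C] [Linear k C] [MonoidalCategory C]
  [MonoidalPreadditive C] [MonoidalLinear k C] [RigidCategory C]

namespace ProlongationFunctor

variable (S : ProlongationFunctor M k C)

/-- The ind-object `τ X = colim_i τ_i X` of `C`, for `X` in `C`. -/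
def tau : C ⥤ Ind C := S.τ ⋙ Plng.toSys M k C ⋙ Ind.lim M.I

/-- The canonical map `τ_i X ⟶ τ X`. -/
def tauι (i : M.I) (X : C) : Ind.yoneda.obj ((S.T i).obj X) ⟶ S.tau.obj X :=
  colimit.ι ((S.τ.obj X).sys ⋙ Ind.yoneda) i

/-- The extension of `τ` to ind-objects by filtered colimits. -/
def indTau : Ind C ⥤ Ind C := (Ind.yoneda (C := C)).pointwiseLeftKanExtension S.tau

/-- The morphism `τ_i A ⟶ τ A ⟶ τ X` induced by a morphism `A ⟶ X` from an object of `C`. -/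
def push (i : M.I) {A : C} {X : Ind C} (x : Ind.yoneda.obj A ⟶ X) :
    Ind.yoneda.obj ((S.T i).obj A) ⟶ S.indTau.obj X :=
  S.tauι i A ≫ ((Ind.yoneda (C := C)).pointwiseLeftKanExtensionUnit S.tau).app A ≫ S.indTau.map x

end ProlongationFunctor

variable [SymmetricCategory C]

open Functor.OplaxMonoidal in
/-- Let `W`, `B` be algebras in `C`. The tensor structure makes `τ W` an algebra for `⊗^E`, with
multiplication `τ W ⊗^E τ W = τ (W ⊗ W) ⟶ τ W` and unit `E^∨ = τ 𝟙 ⟶ τ W`. The morphism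
`t : τ W ⟶ B` is an algebra map: `τ W ⊗^E τ W ⟶ τ W ⟶ B` is the
restriction of `τ W ⊗ τ W ⟶ B ⊗ B ⟶ B`, and `E^∨ ⟶ τ W ⟶ B` is evaluation at `1`
followed by the unit of `B`. -/
structure TensorProlongationFunctor.IsAlgMap (S : TensorProlongationFunctor M k C)
    (W B : IndAlg C) (t : S.indTau.obj W.X ⟶ B.X) : Prop where
  map_mul : ∀ (i) {A A' : C} (x : Ind.yoneda.obj A ⟶ W.X) (y : Ind.yoneda.obj A' ⟶ W.X),
    S.push i (W.pmul x y) ≫ t =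
      Ind.yoneda.map (δ (S.T i) A A') ≫ B.pmul (S.push i x ≫ t) (S.push i y ≫ t)
  map_one : ∀ i, S.push i W.one ≫ t = Ind.yoneda.map (η (S.T i)) ≫ B.one

namespace EStructure

/-- An algebra in `C` with an `E`-structure `d : τ X ⟶ X`: an algebra map with `d ∘ a = id` and
`d ∘ τ d = d ∘ m ∘ b`, where `m ∘ b : τ τ X ⟶ m^! τ X ⟶ τ X`. -/
structure EAlg (S : EStructure M k C) where
  alg : IndAlg C
  d : S.indTau.obj alg.X ⟶ alg.X
  isAlgMap : S.IsAlgMap alg alg d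
  d_a : ∀ {l : M.I} (g : M.E₀ l →ₐ[k₀] k₀) (hg : M.IsBase g) {A : C}
    (x : Ind.yoneda.obj A ⟶ alg.X),
    Ind.yoneda.map ((S.a g hg).app A) ≫ S.push l x ≫ d = x
  d_d : ∀ {i j l : M.I} (f : M.E₀ l →ₐ[k₀] (M.E₀ i ⊗[k₀] M.E₀ j)) (hf : M.IsProd f) {A : C}
    (x : Ind.yoneda.obj A ⟶ alg.X),
    S.push i (S.push j x ≫ d) ≫ d = Ind.yoneda.map ((S.b f hf).app A) ≫ S.push l x ≫ d

variable {S : EStructure M k C}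

/-- Algebra maps that preserve the `E`-structures. -/
@[ext]
structure EAlg.Hom (X Y : S.EAlg) where
  hom : X.alg ⟶ Y.alg
  comm : S.indTau.map hom.hom ≫ Y.d = X.d ≫ hom.hom

instance : Category S.EAlg where
  Hom := EAlg.Hom
  id X := ⟨𝟙 X.alg, by
    change S.indTau.map (𝟙 X.alg.X) ≫ X.d = X.d ≫ 𝟙 X.alg.X
    rw [CategoryTheory.Functor.map_id, Category.id_comp, Category.comp_id]⟩
  comp {X Y Z} f g := ⟨f.hom ≫ g.hom, by
    change S.indTau.map (f.hom.hom ≫ g.hom.hom) ≫ Z.d = X.d ≫ f.hom.hom ≫ g.hom.hom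
    rw [Functor.map_comp, Category.assoc, g.comm, ← Category.assoc, f.comm, Category.assoc]⟩
  id_comp f := by apply EAlg.Hom.ext; exact Category.id_comp _
  comp_id f := by apply EAlg.Hom.ext; exact Category.comp_id _
  assoc f g h := by apply EAlg.Hom.ext; exact Category.assoc _ _ _

variable (S)

/-- The functor forgetting the `E`-structure of an algebra. -/
def forgetAlg : S.EAlg ⥤ IndAlg C where
  obj X := X.alg
  map f := f.hom

/-- Affine `M`-schemes in `C`. -/
abbrev MSch := S.EAlgᵒᵖ

/-- The forgetful functor from affine `M`-schemes to affine schemes in `C`. -/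
abbrev forgetSch : S.MSch ⥤ (IndAlg C)ᵒᵖ := S.forgetAlg.op

/-- The isomorphisms `a` and `b` are compatible with the unit and associativity constraints of the
monoid: `X ↦ τ X` with `X ⟶ τ X` and `τ τ X ⟶ m^! τ X ⟶ τ X` satisfies the unit laws and
associativity of a monad. -/
structure IsCoherent : Prop where
  left_unit : ∀ {i j l : M.I} (f : M.E₀ l →ₐ[k₀] (M.E₀ i ⊗[k₀] M.E₀ j)) (hf : M.IsProd f)
    (g : M.E₀ i →ₐ[k₀] k₀) (hg : M.IsBase g) (X : C),
    Ind.yoneda.map ((S.a g hg).app ((S.T j).obj X) ≫ (S.b f hf).app X) ≫ S.tauι l X = S.tauι j X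
  right_unit : ∀ {i j l : M.I} (f : M.E₀ l →ₐ[k₀] (M.E₀ i ⊗[k₀] M.E₀ j)) (hf : M.IsProd f)
    (g : M.E₀ j →ₐ[k₀] k₀) (hg : M.IsBase g) (X : C),
    Ind.yoneda.map ((S.T i).map ((S.a g hg).app X) ≫ (S.b f hf).app X) ≫ S.tauι l X = S.tauι i X
  assoc : ∀ {i₁ i₂ i₃ n n' l l' : M.I}
    (f : M.E₀ n →ₐ[k₀] (M.E₀ i₂ ⊗[k₀] M.E₀ i₃)) (hf : M.IsProd f)
    (h : M.E₀ l →ₐ[k₀] (M.E₀ i₁ ⊗[k₀] M.E₀ n)) (hh : M.IsProd h)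
    (f' : M.E₀ n' →ₐ[k₀] (M.E₀ i₁ ⊗[k₀] M.E₀ i₂)) (hf' : M.IsProd f')
    (h' : M.E₀ l' →ₐ[k₀] (M.E₀ n' ⊗[k₀] M.E₀ i₃)) (hh' : M.IsProd h') (X : C),
    Ind.yoneda.map ((S.T i₁).map ((S.b f hf).app X) ≫ (S.b h hh).app X) ≫ S.tauι l X =
      Ind.yoneda.map ((S.b f' hf').app ((S.T i₃).obj X) ≫ (S.b h' hh').app X) ≫ S.tauι l' X

end EStructure

end MSchemes

end

/-! On algebras, the first claim asks for a left adjoint of the functor forgetting the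
`E`-structure. An ind-object is determined by its points `A ⟶ X` with `A` in `C`, and a structure
map `τ X ⟶ X` amounts to operations `X(A) → X(τ_i A)` subject to identities (`IsPointAction`).
Algebras with `E`-structure under `W` are thus the models of an equational theory, and the free one
on `W` is an initial model (`OpSignature.Model.exists_initial`, `EAlg.exists_free`). Its points are
the families, indexed by all models, that are values of a single formal term; terms form a set
although models do not. To be the points of an ind-object, these families need a filtered category
of elements, and the partially defined terms `pair` and `desc` provide the cocones. Identities hold
in the resulting algebra because its maps to the models separate points. Coherence plays no role
here.

If the `E`-structure is coherent, `τ` obeys the laws of a monad. For an algebra `B` the presheaf `A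
↦ Hom(τ A, B)` is an ind-object because `τ` is right exact, and an algebra because `τ` is a tensor
functor (`exists_coprolongation`). Composition with `τ τ ⟶ τ` gives it an `E`-structure; call the
result `F` (`IsCoherent.exists_cofree`). For `Y` free on `W`, algebra maps `τ W ⟶ B` are algebra
maps `W ⟶ F`, hence maps `Y ⟶ F` preserving `E`-structures, hence algebra maps `Y ⟶ B`
(`IsCoherent.existsUnique_hom_of_free`). The detour through `F` avoids putting an algebra structure
for `⊗` on `τ W`, which only has one for `⊗^E`.

Affine spaces come from the same initial model theorem, with one constant and no operations. The
free algebra with `E`-structure on such an algebra is obtained by composing the two universal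
properties. -/

noncomputable section

/-! ### Ind-objects through their points -/

namespace CategoryTheory.Ind

variable {C : Type u} [SmallCategory C]

/-- The points of an ind-object with values in an object of `C`. -/
abbrev Point (X : Ind C) (A : C) : Type u := Ind.yoneda.obj A ⟶ X

/-- The points of an ind-object are the sections of the corresponding presheaf. -/
def pointEquiv (X : Ind C) (A : C) : X.Point A ≃ ((Ind.inclusion C).obj X).obj (op A) :=
  (Ind.inclusion.fullyFaithful.homEquiv.trans
    ((Ind.yonedaCompInclusion.app A).homFromEquiv)).trans yonedaEquiv

theorem pointEquiv_comp {X Y : Ind C} {A : C} (x : X.Point A) (g : X ⟶ Y) :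
    Y.pointEquiv A (x ≫ g) = ((Ind.inclusion C).map g).app (op A) (X.pointEquiv A x) := by
  change yonedaEquiv (Ind.yonedaCompInclusion.inv.app A ≫ (Ind.inclusion C).map (x ≫ g)) = _
  rw [Functor.map_comp, ← Category.assoc]
  rfl

theorem pointEquiv_map (X : Ind C) {A B : C} (f : A ⟶ B) (x : X.Point B) :
    X.pointEquiv A (Ind.yoneda.map f ≫ x) =
      ((Ind.inclusion C).obj X).map f.op (X.pointEquiv B x) := by
  change yonedaEquiv (Ind.yonedaCompInclusion.inv.app A ≫
    (Ind.inclusion C).map (Ind.yoneda.map f ≫ x)) = ((Ind.inclusion C).obj X).map f.op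
      (yonedaEquiv (Ind.yonedaCompInclusion.inv.app B ≫ (Ind.inclusion C).map x))
  rw [yonedaEquiv_naturality, Functor.map_comp, ← Category.assoc, ← Category.assoc]
  congr 2
  exact (Ind.yonedaCompInclusion.inv.naturality f).symm

/-- `Ind.inclusion` is faithful, and the sections of the presheaf it attaches to `X` are the points
of `X`. -/
theorem hom_ext {X Y : Ind C} {f g : X ⟶ Y} (h : ∀ (A : C) (x : X.Point A), x ≫ f = x ≫ g) :
    f = g := by
  apply (Ind.inclusion C).map_injective
  ext ⟨A⟩ x
  obtain ⟨x, rfl⟩ := (X.pointEquiv A).surjective x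
  exact (pointEquiv_comp x f).symm.trans ((congrArg _ (h A x)).trans (pointEquiv_comp x g))

/-- A natural map on points comes from a morphism of ind-objects. -/
theorem exists_hom_of_points {X Y : Ind C} (φ : ∀ A, X.Point A → Y.Point A)
    (hφ : ∀ {A B : C} (f : A ⟶ B) (x : X.Point B),
      φ A (Ind.yoneda.map f ≫ x) = Ind.yoneda.map f ≫ φ B x) :
    ∃ g : X ⟶ Y, ∀ {A : C} (x : X.Point A), x ≫ g = φ A x := by
  refine ⟨(Ind.inclusion C).preimage
    { app := fun A => ↾fun s => Y.pointEquiv A.unop (φ _ ((X.pointEquiv A.unop).symm s))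
      naturality := ?_ }, ?_⟩
  · rintro ⟨B⟩ ⟨A⟩ f
    ext s
    obtain ⟨x, rfl⟩ := (X.pointEquiv B).surjective s
    have := pointEquiv_map X f.unop x
    have h2 := pointEquiv_map Y f.unop (φ B x)
    simp only [Quiver.Hom.op_unop] at this h2
    simp [← this, ← h2, hφ]
  · intro A x
    apply (Y.pointEquiv A).injective
    rw [pointEquiv_comp, Functor.map_preimage]
    simp

/-- A presheaf whose category of elements is filtered is the presheaf of points of an ind-object. -/
theorem exists_pointEquiv (P : C → Type u) (res : ∀ {A B : C}, (A ⟶ B) → P B → P A)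
    (res_id : ∀ {A : C} (x : P A), res (𝟙 A) x = x)
    (res_comp : ∀ {A B D : C} (f : A ⟶ B) (g : B ⟶ D) (x : P D), res (f ≫ g) x = res f (res g x))
    (h₀ : ∃ A, Nonempty (P A))
    (h₁ : ∀ {A B : C} (x : P A) (y : P B),
      ∃ (D : C) (f : A ⟶ D) (g : B ⟶ D) (z : P D), res f z = x ∧ res g z = y)
    (h₂ : ∀ {A B : C} (f g : A ⟶ B) (y : P B), res f y = res g y →
      ∃ (D : C) (h : B ⟶ D) (z : P D), res h z = y ∧ f ≫ h = g ≫ h) :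
    ∃ (X : Ind C) (e : ∀ A, X.Point A ≃ P A),
      ∀ {A B : C} (f : A ⟶ B) (x : X.Point B), e A (Ind.yoneda.map f ≫ x) = res f (e B x) := by
  let F : Cᵒᵖ ⥤ Type u :=
    { obj A := P A.unop
      map f := ↾res f.unop
      map_id A := by ext x; exact res_id x
      map_comp f g := by ext x; exact res_comp g.unop f.unop x }
  have hne : Nonempty (CostructuredArrow yoneda F) := by
    obtain ⟨A, ⟨x⟩⟩ := h₀
    exact ⟨CostructuredArrow.mk (Y := A) (yonedaEquiv.symm x)⟩
  -- By Yoneda, costructured arrows over `F` are elements of `P`; `h₁` and `h₂` are then the two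
  -- cocone conditions for a filtered category.
  have : IsFilteredOrEmpty (CostructuredArrow yoneda F) := by
    refine ⟨fun X Y => ?_, fun X Y f g => ?_⟩
    · obtain ⟨D, f, g, z, hf, hg⟩ := h₁ (yonedaEquiv X.hom) (yonedaEquiv Y.hom)
      refine ⟨CostructuredArrow.mk (Y := D) (yonedaEquiv.symm z), CostructuredArrow.homMk f ?_,
        CostructuredArrow.homMk g ?_, trivial⟩
      · exact (yonedaEquiv_symm_naturality_left f F z).trans
          (yonedaEquiv.symm_apply_eq.2 hf)
      · exact (yonedaEquiv_symm_naturality_left g F z).trans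
          (yonedaEquiv.symm_apply_eq.2 hg)
    · obtain ⟨D, h, z, hz, hfg⟩ := h₂ f.left g.left (yonedaEquiv Y.hom)
        ((yonedaEquiv_naturality _ _).trans ((congrArg yonedaEquiv
          ((CostructuredArrow.w f).trans (CostructuredArrow.w g).symm)).trans
            (yonedaEquiv_naturality _ _).symm))
      refine ⟨CostructuredArrow.mk (Y := D) (yonedaEquiv.symm z), CostructuredArrow.homMk h ?_, ?_⟩
      · exact (yonedaEquiv_symm_naturality_left h F z).trans
          (yonedaEquiv.symm_apply_eq.2 hz)
      · ext
        exact hfg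
  have : IsFiltered (CostructuredArrow yoneda F) := ⟨⟩
  -- `C` is small, so the category of elements is small; this gives the size condition in the
  -- criterion for ind-objects.
  have := essentiallySmallSelf (CostructuredArrow yoneda F)
  have := finallySmall_of_essentiallySmall.{u} (J := CostructuredArrow yoneda F)
  have hF : IsIndObject F := isIndObject_of_isFiltered_of_finallySmall F
  let i : (Ind.inclusion C).obj ((Ind.equivalence C).inverse.obj ⟨F, hF⟩) ≅ F :=
    (ObjectProperty.ι _).mapIso ((Ind.equivalence C).counitIso.app ⟨F, hF⟩)
  refine ⟨(Ind.equivalence C).inverse.obj ⟨F, hF⟩,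
    fun A => (pointEquiv _ A).trans (i.app (op A)).toEquiv, fun {A B} f x => ?_⟩
  have := NatTrans.naturality_apply i.hom f.op (pointEquiv _ B x)
  simp only [Equiv.trans_apply, pointEquiv_map]
  exact this

/-! ### Pointwise left Kan extensions as colimits -/

section

variable {B D E : Type*} [Category B] [Category D] [Category E] (L : B ⥤ D) (F : B ⥤ E)
  [L.HasPointwiseLeftKanExtension F]

/-- The coprojection of a pointwise left Kan extension at `x : L.obj A ⟶ X`. -/
def lanι {X : D} {A : B} (x : L.obj A ⟶ X) : F.obj A ⟶ (L.pointwiseLeftKanExtension F).obj X :=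
  colimit.ι (CostructuredArrow.proj L X ⋙ F) (CostructuredArrow.mk x)

theorem lanι_map {X X' : D} {A : B} (x : L.obj A ⟶ X) (f : X ⟶ X') :
    lanι L F x ≫ (L.pointwiseLeftKanExtension F).map f = lanι L F (x ≫ f) :=
  colimit.ι_desc _ _

theorem map_lanι {X : D} {A A' : B} (f : A ⟶ A') (x : L.obj A' ⟶ X) :
    F.map f ≫ lanι L F x = lanι L F (L.map f ≫ x) :=
  colimit.w (CostructuredArrow.proj L X ⋙ F)
    (CostructuredArrow.homMk f : CostructuredArrow.mk (L.map f ≫ x) ⟶ CostructuredArrow.mk x)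

theorem unit_map {X : D} {A : B} (x : L.obj A ⟶ X) :
    (L.pointwiseLeftKanExtensionUnit F).app A ≫ (L.pointwiseLeftKanExtension F).map x =
      lanι L F x :=
  (lanι_map L F (𝟙 _) x).trans (by rw [Category.id_comp])

theorem lan_hom_ext {X : D} {Z : E} {f g : (L.pointwiseLeftKanExtension F).obj X ⟶ Z}
    (h : ∀ {A : B} (x : L.obj A ⟶ X), lanι L F x ≫ f = lanι L F x ≫ g) : f = g :=
  colimit.hom_ext fun j => h j.hom

/-- The extension is a colimit over the arrows `L.obj A ⟶ X`, and `hφ` says that `φ` is a cocone on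
that diagram. -/
theorem exists_lan_hom {X : D} {Z : E} (φ : ∀ A : B, (L.obj A ⟶ X) → (F.obj A ⟶ Z))
    (hφ : ∀ {A A' : B} (f : A ⟶ A') (x : L.obj A' ⟶ X), φ A (L.map f ≫ x) = F.map f ≫ φ A' x) :
    ∃ m : (L.pointwiseLeftKanExtension F).obj X ⟶ Z, ∀ {A : B} (x : L.obj A ⟶ X),
      lanι L F x ≫ m = φ A x :=
  ⟨colimit.desc (CostructuredArrow.proj L X ⋙ F) ⟨Z, {
    app := fun j => φ _ j.hom
    naturality := fun j j' t => by
      have := hφ t.left j'.hom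
      rw [CostructuredArrow.w] at this
      exact this.symm.trans (Category.comp_id _).symm }⟩,
    fun x => colimit.ι_desc _ (CostructuredArrow.mk x)⟩

end

end CategoryTheory.Ind

/-! ### The tensor product of ind-objects through points -/

section Tensor

variable {C : Type u} [SmallCategory C] [Abelian C] [MonoidalCategory C]

theorem indTensorHom_eq_lanι {A B : C} {X Y : Ind C} (x : X.Point A) (y : Y.Point B) :
    indTensorHom x y = Ind.lanι (Functor.prod (Ind.yoneda (C := C)) (Ind.yoneda (C := C)))
      (tensor C ⋙ Ind.yoneda) (A := (A, B)) (X := (X, Y)) (x, y) :=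
  Ind.unit_map _ _ (A := (A, B)) _

theorem indTensorHom_map {A B : C} {X Y X' Y' : Ind C} (x : X.Point A) (y : Y.Point B)
    (f : X ⟶ X') (g : Y ⟶ Y') :
    indTensorHom x y ≫ (indTensor C).map ((f, g) : (X, Y) ⟶ (X', Y')) =
      indTensorHom (x ≫ f) (y ≫ g) := by
  rw [indTensorHom_eq_lanι, indTensorHom_eq_lanι]
  exact Ind.lanι_map _ _ _ _

theorem indTensorHom_precomp {A A' B B' : C} {X Y : Ind C} (f : A ⟶ A') (g : B ⟶ B')
    (x : X.Point A') (y : Y.Point B') :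
    indTensorHom (Ind.yoneda.map f ≫ x) (Ind.yoneda.map g ≫ y) =
      Ind.yoneda.map (f ⊗ₘ g) ≫ indTensorHom x y := by
  rw [indTensorHom_eq_lanι, indTensorHom_eq_lanι]
  exact (Ind.map_lanι (Functor.prod (Ind.yoneda (C := C)) (Ind.yoneda (C := C)))
      (tensor C ⋙ Ind.yoneda) (A := (A, B)) (A' := (A', B')) (X := (X, Y)) (f, g) (x, y)).symm

theorem indTensor_hom_ext {X Y Z : Ind C} {f g : (indTensor C).obj (X, Y) ⟶ Z}
    (h : ∀ {A B : C} (x : X.Point A) (y : Y.Point B), indTensorHom x y ≫ f = indTensorHom x y ≫ g) :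
    f = g := by
  refine Ind.lan_hom_ext _ _ fun {A} x => ?_
  have := h x.1 x.2
  rwa [indTensorHom_eq_lanι] at this

/-- As for Day convolution, a morphism out of a tensor product is a pairing of points natural in
both variables. -/
theorem exists_indTensor_hom {X Y Z : Ind C} (φ : ∀ A B, X.Point A → Y.Point B → Z.Point (A ⊗ B))
    (hφ : ∀ {A A' B B' : C} (f : A ⟶ A') (g : B ⟶ B') (x : X.Point A') (y : Y.Point B'),
      φ A B (Ind.yoneda.map f ≫ x) (Ind.yoneda.map g ≫ y) =
        Ind.yoneda.map (f ⊗ₘ g) ≫ φ A' B' x y) :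
    ∃ m : (indTensor C).obj (X, Y) ⟶ Z, ∀ {A B : C} (x : X.Point A) (y : Y.Point B),
      indTensorHom x y ≫ m = φ A B x y := by
  obtain ⟨m, hm⟩ := Ind.exists_lan_hom (Functor.prod (Ind.yoneda (C := C)) (Ind.yoneda (C := C)))
    (tensor C ⋙ Ind.yoneda) (X := (X, Y)) (Z := Z) (fun A x => φ A.1 A.2 x.1 x.2)
    (fun f x => hφ f.1 f.2 x.1 x.2)
  refine ⟨m, fun x y => ?_⟩
  rw [indTensorHom_eq_lanι]
  exact hm _

end Tensor

/-! ### Algebras through points -/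

namespace IndAlg

variable {C : Type u} [SmallCategory C] [Abelian C] [MonoidalCategory C] [SymmetricCategory C]

theorem pmul_precomp (X : IndAlg C) {A A' B B' : C} (f : A ⟶ A') (g : B ⟶ B')
    (x : X.X.Point A') (y : X.X.Point B') :
    X.pmul (Ind.yoneda.map f ≫ x) (Ind.yoneda.map g ≫ y) =
      Ind.yoneda.map (f ⊗ₘ g) ≫ X.pmul x y := by
  simp only [pmul]
  rw [indTensorHom_precomp, Category.assoc]

theorem pmul_comp_hom {X Y : IndAlg C} (f : X ⟶ Y) {A B : C} (x : X.X.Point A) (y : X.X.Point B) :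
    X.pmul x y ≫ f.hom = Y.pmul (x ≫ f.hom) (y ≫ f.hom) := by
  simp only [pmul]
  rw [Category.assoc, f.map_mul, ← Category.assoc, indTensorHom_map]

/-- A natural map on points that respects products and the unit comes from a morphism of
algebras. -/
theorem exists_hom_of_points {X Y : IndAlg C} (φ : ∀ A, X.X.Point A → Y.X.Point A)
    (hφ : ∀ {A B : C} (f : A ⟶ B) (x : X.X.Point B),
      φ A (Ind.yoneda.map f ≫ x) = Ind.yoneda.map f ≫ φ B x)
    (hmul : ∀ {A B : C} (x : X.X.Point A) (y : X.X.Point B),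
      φ _ (X.pmul x y) = Y.pmul (φ A x) (φ B y))
    (hone : φ _ X.one = Y.one) :
    ∃ g : X ⟶ Y, ∀ {A : C} (x : X.X.Point A), x ≫ g.hom = φ A x := by
  obtain ⟨g, hg⟩ := Ind.exists_hom_of_points φ hφ
  refine ⟨⟨g, indTensor_hom_ext fun x y => ?_, by rw [hg, hone]⟩, hg⟩
  have := hmul x y
  rw [← hg, ← hg, ← hg] at this
  rw [← Category.assoc, ← Category.assoc, indTensorHom_map]
  exact this

theorem hom_ext_points {X Y : IndAlg C} {f g : X ⟶ Y}
    (h : ∀ {A : C} (x : X.X.Point A), x ≫ f.hom = x ≫ g.hom) : f = g :=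
  Hom.ext (Ind.hom_ext fun _ x => h x)

/-- A lax symmetric monoidal structure on a presheaf whose category of elements is filtered
defines an algebra. -/
theorem exists_of_presheaf (P : C → Type u) (res : ∀ {A B : C}, (A ⟶ B) → P B → P A)
    (mul : ∀ {A B : C}, P A → P B → P (A ⊗ B)) (one : P (𝟙_ C))
    (res_id : ∀ {A : C} (x : P A), res (𝟙 A) x = x)
    (res_comp : ∀ {A B D : C} (f : A ⟶ B) (g : B ⟶ D) (x : P D), res (f ≫ g) x = res f (res g x))
    (h₁ : ∀ {A B : C} (x : P A) (y : P B),
      ∃ (D : C) (f : A ⟶ D) (g : B ⟶ D) (z : P D), res f z = x ∧ res g z = y)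
    (h₂ : ∀ {A B : C} (f g : A ⟶ B) (y : P B), res f y = res g y →
      ∃ (D : C) (h : B ⟶ D) (z : P D), res h z = y ∧ f ≫ h = g ≫ h)
    (map_mul : ∀ {A A' B B' : C} (f : A ⟶ A') (g : B ⟶ B') (x : P A') (y : P B'),
      mul (res f x) (res g y) = res (f ⊗ₘ g) (mul x y))
    (mul_assoc : ∀ {A₁ A₂ A₃ : C} (x : P A₁) (y : P A₂) (z : P A₃),
      mul (mul x y) z = res (α_ A₁ A₂ A₃).hom (mul x (mul y z)))
    (one_mul : ∀ {A : C} (x : P A), mul one x = res (λ_ A).hom x)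
    (mul_comm : ∀ {A B : C} (x : P A) (y : P B), mul x y = res (β_ A B).hom (mul y x)) :
    ∃ (X : IndAlg C) (e : ∀ A, X.X.Point A ≃ P A),
      (∀ {A B : C} (f : A ⟶ B) (x : X.X.Point B), e A (Ind.yoneda.map f ≫ x) = res f (e B x)) ∧
      (∀ {A B : C} (x : X.X.Point A) (y : X.X.Point B),
        e _ (X.pmul x y) = mul (e A x) (e B y)) ∧
      e _ X.one = one := by
  obtain ⟨X, e, he⟩ := Ind.exists_pointEquiv P res res_id res_comp ⟨_, ⟨one⟩⟩ h₁ h₂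
  -- The multiplication of the presheaf, transported along `e`, is a natural pairing and so defines
  -- `X ⊗ X ⟶ X`.
  obtain ⟨m, hm⟩ := exists_indTensor_hom (X := X) (Y := X) (Z := X)
    (fun A B x y => (e _).symm (mul (e A x) (e B y))) (fun f g x y => by
      apply (e _).injective
      rw [Equiv.apply_symm_apply, he, he, he, Equiv.apply_symm_apply, map_mul])
  refine ⟨⟨X, m, (e _).symm one, ?_, ?_, ?_⟩, e, he, ?_, by simp⟩
  · intro A₁ A₂ A₃ x y z
    apply (e _).injective
    rw [he]
    simp [hm, mul_assoc]
  · intro A x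
    apply (e _).injective
    rw [he]
    simp [hm, one_mul]
  · intro A B x y
    apply (e _).injective
    rw [he]
    simp only [hm, Equiv.apply_symm_apply]
    exact mul_comm _ _
  · intro A B x y
    simp [pmul, hm]

end IndAlg

/-! ### Initial algebras with operations -/

namespace CategoryTheory.Ind

variable {C : Type u} [SmallCategory C]

variable [HasFiniteColimits C] {D : Type*} [Category D] (G : C ⥤ D) [PreservesFiniteColimits G]

/-- This and the next three lemmas say that `A ↦ Hom(G A, X)` takes finite coproducts to products
and coequalizers to equalizers. Its category of elements therefore has the cocones required of an
ind-object. They serve for `G = Ind.yoneda` and for `G = τ`. -/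
theorem exists_map_coprod {X : D} {A B : C} (x : G.obj A ⟶ X) (y : G.obj B ⟶ X) :
    ∃ z : G.obj (A ⨿ B) ⟶ X, G.map coprod.inl ≫ z = x ∧ G.map coprod.inr ≫ z = y := by
  obtain ⟨z, h₁, h₂⟩ := BinaryCofan.IsColimit.desc'
    (isColimitOfHasBinaryCoproductOfPreservesColimit G A B) x y
  exact ⟨z, h₁, h₂⟩

theorem map_coprod_ext {X : D} {A B : C} {z z' : G.obj (A ⨿ B) ⟶ X}
    (h₁ : G.map coprod.inl ≫ z = G.map coprod.inl ≫ z')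
    (h₂ : G.map coprod.inr ≫ z = G.map coprod.inr ≫ z') : z = z' :=
  BinaryCofan.IsColimit.hom_ext (isColimitOfHasBinaryCoproductOfPreservesColimit G A B) h₁ h₂

theorem exists_map_coequalizer {X : D} {A B : C} (f g : A ⟶ B) (y : G.obj B ⟶ X)
    (h : G.map f ≫ y = G.map g ≫ y) :
    ∃ z : G.obj (coequalizer f g) ⟶ X, G.map (coequalizer.π f g) ≫ z = y := by
  obtain ⟨z, hz⟩ := Cofork.IsColimit.desc'
    (isColimitOfHasCoequalizerOfPreservesColimit G f g) y h
  exact ⟨z, hz⟩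

theorem map_coequalizer_ext {X : D} {A B : C} {f g : A ⟶ B} {z z' : G.obj (coequalizer f g) ⟶ X}
    (h : G.map (coequalizer.π f g) ≫ z = G.map (coequalizer.π f g) ≫ z') : z = z' :=
  Cofork.IsColimit.hom_ext (isColimitOfHasCoequalizerOfPreservesColimit G f g) h

end CategoryTheory.Ind

/-- A signature of additional structure on algebras in `C`: constants and unary operations. -/
structure OpSignature (C : Type u) where
  Gen : Type u
  sort : Gen → C
  Op : Type u
  T : Op → C → C

namespace OpSignature

variable {C : Type u} [SmallCategory C] [Abelian C] [MonoidalCategory C]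

/-- Formal expressions in constants, operations, products and the partially defined
operations of gluing along a coproduct and of descending to a coequalizer. -/
inductive Term (σ : OpSignature C) : C → Type u
  | gen (g : σ.Gen) : Term σ (σ.sort g)
  | op (o : σ.Op) {A : C} (s : Term σ A) : Term σ (σ.T o A)
  | map {A B : C} (f : A ⟶ B) (s : Term σ B) : Term σ A
  | mul {A B : C} (s : Term σ A) (t : Term σ B) : Term σ (A ⊗ B)
  | one : Term σ (𝟙_ C)
  | pair {A B : C} (s : Term σ A) (t : Term σ B) : Term σ (A ⨿ B)
  | desc {A B : C} (f g : A ⟶ B) (s : Term σ B) : Term σ (coequalizer f g)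

variable [SymmetricCategory C]

/-- An algebra in `C` with the structure prescribed by a signature. -/
structure Model (σ : OpSignature C) where
  alg : IndAlg C
  gen : ∀ g : σ.Gen, alg.X.Point (σ.sort g)
  op : ∀ (o : σ.Op) {A : C}, alg.X.Point A → alg.X.Point (σ.T o A)

namespace Model

variable {σ : OpSignature C}

/-- Algebra maps that preserve the constants and operations. -/
structure IsHom (M N : σ.Model) (f : M.alg ⟶ N.alg) : Prop where
  gen : ∀ g, M.gen g ≫ f.hom = N.gen g
  op : ∀ (o : σ.Op) {A : C} (x : M.alg.X.Point A), M.op o x ≫ f.hom = N.op o (x ≫ f.hom)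

/-- The term `s` has the value `z` in `N`. -/
def Eval (N : σ.Model) : ∀ {A : C}, σ.Term A → N.alg.X.Point A → Prop
  | _, .gen g, z => z = N.gen g
  | _, .op o s, z => ∃ x, N.Eval s x ∧ z = N.op o x
  | _, .map f s, z => ∃ x, N.Eval s x ∧ z = Ind.yoneda.map f ≫ x
  | _, .mul s t, z => ∃ x y, N.Eval s x ∧ N.Eval t y ∧ z = N.alg.pmul x y
  | _, .one, z => z = N.alg.one
  | _, .pair s t, z =>
    N.Eval s (Ind.yoneda.map coprod.inl ≫ z) ∧ N.Eval t (Ind.yoneda.map coprod.inr ≫ z)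
  | _, .desc f g s, z => N.Eval s (Ind.yoneda.map (coequalizer.π f g) ≫ z)

/-- The terms `pair` and `desc` may have no value, but never two: a morphism out of a coproduct or a
coequalizer is determined by its restrictions. -/
theorem Eval.unique (N : σ.Model) {A : C} {s : σ.Term A} {z z' : N.alg.X.Point A}
    (h : N.Eval s z) (h' : N.Eval s z') : z = z' := by
  induction s with
  | gen g => exact Eq.trans h (Eq.symm h')
  | one => exact Eq.trans h (Eq.symm h')
  | op o s ih =>
    obtain ⟨x, hx, rfl⟩ := h
    obtain ⟨y, hy, rfl⟩ := h'
    rw [ih hx hy]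
  | map f s ih =>
    obtain ⟨x, hx, rfl⟩ := h
    obtain ⟨y, hy, rfl⟩ := h'
    rw [ih hx hy]
  | mul s t ihs iht =>
    obtain ⟨x, y, hx, hy, rfl⟩ := h
    obtain ⟨x', y', hx', hy', rfl⟩ := h'
    rw [ihs hx hx', iht hy hy']
  | pair s t ihs iht => exact Ind.map_coprod_ext Ind.yoneda (ihs h.1 h'.1) (iht h.2 h'.2)
  | desc f g s ih => exact Ind.map_coequalizer_ext Ind.yoneda (ih h h')

variable (K : σ.Model → Prop)

/-- A family of points of the models in a class that is the value of a term. -/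
def LargeFamily (A : C) : Type (u + 1) :=
  { φ : ∀ N : { N // K N }, N.1.alg.X.Point A //
    ∃ s : σ.Term A, ∀ N : { N // K N }, N.1.Eval s (φ N) }

/-- The class of models is large, but by `Eval.unique` a family is determined by any term describing
it, and the terms live in the universe of `C`. -/
instance (A : C) : Small.{u} (LargeFamily K A) :=
  small_of_surjective
    (f := fun s : { s : σ.Term A // ∃ φ : ∀ N : { N // K N }, N.1.alg.X.Point A,
      ∀ N : { N // K N }, N.1.Eval s (φ N) } =>
        (⟨s.2.choose, s.1, s.2.choose_spec⟩ : LargeFamily K A))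
    fun ⟨φ, s, hs⟩ => ⟨⟨s, φ, hs⟩, Subtype.ext (funext fun N =>
      Eval.unique N.1 (Exists.choose_spec (p := fun φ : ∀ N : { N // K N }, N.1.alg.X.Point A =>
        ∀ N : { N // K N }, N.1.Eval s (φ N)) ⟨φ, hs⟩ N) (hs N))⟩

/-- Families of points that are values of terms, in the universe of `C`. -/
def Family (A : C) : Type u := Shrink.{u} (LargeFamily K A)

namespace Family

variable {K}

/-- The value of a family in a model. -/
def val {A : C} (x : Family K A) (N : { N // K N }) : N.1.alg.X.Point A :=
  ((equivShrink (LargeFamily K A)).symm x).1 N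

theorem exists_term {A : C} (x : Family K A) :
    ∃ s : σ.Term A, ∀ N : { N // K N }, N.1.Eval s (x.val N) :=
  ((equivShrink (LargeFamily K A)).symm x).2

theorem ext {A : C} {x y : Family K A} (h : ∀ N, x.val N = y.val N) : x = y :=
  (equivShrink (LargeFamily K A)).symm.injective (Subtype.ext (funext h))

/-- The family with given values. -/
def mk {A : C} (φ : ∀ N : { N // K N }, N.1.alg.X.Point A)
    (hφ : ∃ s : σ.Term A, ∀ N : { N // K N }, N.1.Eval s (φ N)) : Family K A :=
  equivShrink (LargeFamily K A) ⟨φ, hφ⟩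

@[simp]
theorem val_mk {A : C} (φ : ∀ N : { N // K N }, N.1.alg.X.Point A)
    (hφ : ∃ s : σ.Term A, ∀ N : { N // K N }, N.1.Eval s (φ N)) (N) :
    (Family.mk φ hφ).val N = φ N :=
  congrFun (congrArg Subtype.val ((equivShrink (LargeFamily K A)).symm_apply_apply ⟨φ, hφ⟩)) N

/-- Restriction of families. -/
def res {A B : C} (f : A ⟶ B) (x : Family K B) : Family K A :=
  Family.mk (fun N => Ind.yoneda.map f ≫ x.val N) (by
    obtain ⟨s, hs⟩ := x.exists_term
    exact ⟨.map f s, fun N => ⟨_, hs N, rfl⟩⟩)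

@[simp]
theorem val_res {A B : C} (f : A ⟶ B) (x : Family K B) (N) :
    (res f x).val N = Ind.yoneda.map f ≫ x.val N :=
  val_mk _ _ _

/-- The product of families. -/
def mul {A B : C} (x : Family K A) (y : Family K B) : Family K (A ⊗ B) :=
  Family.mk (fun N => N.1.alg.pmul (x.val N) (y.val N)) (by
    obtain ⟨s, hs⟩ := x.exists_term
    obtain ⟨t, ht⟩ := y.exists_term
    exact ⟨.mul s t, fun N => ⟨_, _, hs N, ht N, rfl⟩⟩)

@[simp]
theorem val_mul {A B : C} (x : Family K A) (y : Family K B) (N) :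
    (mul x y).val N = N.1.alg.pmul (x.val N) (y.val N) :=
  val_mk _ _ _

variable (K) in
/-- The family of units. -/
def one : Family K (𝟙_ C) :=
  Family.mk (fun N => N.1.alg.one) ⟨.one, fun _ => rfl⟩

@[simp]
theorem val_one (N) : (one K).val N = N.1.alg.one :=
  val_mk _ _ _

/-- The glueing is done in every model at once, and the result is the value of the term `pair s t`,
so it is again a family. `exists_desc` is the analogue for coequalizers. -/
theorem exists_pair {A B : C} (x : Family K A) (y : Family K B) :
    ∃ (D : C) (f : A ⟶ D) (g : B ⟶ D) (z : Family K D), res f z = x ∧ res g z = y := by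
  choose z h₁ h₂ using fun N => Ind.exists_map_coprod Ind.yoneda (x.val N) (y.val N)
  obtain ⟨s, hs⟩ := x.exists_term
  obtain ⟨t, ht⟩ := y.exists_term
  refine ⟨_, coprod.inl, coprod.inr, Family.mk z ⟨.pair s t, fun N => ⟨?_, ?_⟩⟩,
    Family.ext fun N => ?_, Family.ext fun N => ?_⟩
  · rw [h₁]
    exact hs N
  · rw [h₂]
    exact ht N
  · simp [h₁]
  · simp [h₂]

theorem exists_desc {A B : C} (f g : A ⟶ B) (y : Family K B) (h : res f y = res g y) :
    ∃ (D : C) (h : B ⟶ D) (z : Family K D), res h z = y ∧ f ≫ h = g ≫ h := by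
  have h' : ∀ N, Ind.yoneda.map f ≫ y.val N = Ind.yoneda.map g ≫ y.val N := fun N => by
    simpa using congrArg (fun z => z.val N) h
  choose z hz using fun N => Ind.exists_map_coequalizer Ind.yoneda f g (y.val N) (h' N)
  obtain ⟨s, hs⟩ := y.exists_term
  refine ⟨_, coequalizer.π f g, Family.mk z ⟨.desc f g s, fun N => ?_⟩, Family.ext fun N => ?_,
    coequalizer.condition f g⟩
  · change N.1.Eval s _
    rw [hz]
    exact hs N
  · simp [hz]

end Family

/-- A class of models that contains every model separated by maps to models of the class has an
initial object. -/
theorem exists_initial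
    (hK : ∀ M : σ.Model, (∀ {A : C} (x y : M.alg.X.Point A),
      (∀ (N : σ.Model) (f : M.alg ⟶ N.alg), K N → M.IsHom N f → x ≫ f.hom = y ≫ f.hom) → x = y) →
      K M) :
    ∃ M : σ.Model, K M ∧ ∀ N : σ.Model, K N → ∃! f : M.alg ⟶ N.alg, M.IsHom N f := by
  obtain ⟨X, e, he, hmul, hone⟩ := IndAlg.exists_of_presheaf (Family K)
    Family.res Family.mul (Family.one K)
    (fun x => Family.ext fun N => by simp) (fun f g x => Family.ext fun N => by simp)
    Family.exists_pair Family.exists_desc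
    (fun f g x y => Family.ext fun N => by simp [IndAlg.pmul_precomp])
    (fun x y z => Family.ext fun N => by
      simpa [IndAlg.pmul] using N.1.alg.assoc (x.val N) (y.val N) (z.val N))
    (fun x => Family.ext fun N => by simpa [IndAlg.pmul] using N.1.alg.one_mul (x.val N))
    (fun x y => Family.ext fun N => by
      simpa [IndAlg.pmul] using N.1.alg.comm (x.val N) (y.val N))
  -- Evaluation of families at the model `N` is an algebra map `X ⟶ N`. These maps jointly separate
  -- points, since families are equal when all their values are.
  have hex : ∀ N : { N // K N }, ∃ g : X ⟶ N.1.alg, ∀ {A : C} (x : X.X.Point A),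
      x ≫ g.hom = Family.val (e A x) N := fun N =>
    IndAlg.exists_hom_of_points (fun A x => Family.val (e A x) N)
      (fun f x => by simp [he]) (fun x y => by simp [hmul]) (by simp [hone])
  choose p hp using hex
  have hsep : ∀ {A : C} (x y : X.X.Point A), (∀ N, x ≫ (p N).hom = y ≫ (p N).hom) → x = y :=
    fun {A} x y h => (e A).injective (Family.ext fun N => by rw [← hp, ← hp, h])
  -- The structure is computed in each model separately; the results are families because the terms
  -- `gen` and `op` describe them.
  let M : σ.Model :=
    { alg := X
      gen := fun g => (e _).symm (Family.mk (fun N => N.1.gen g) ⟨.gen g, fun N => rfl⟩)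
      op := fun o A x => (e _).symm (Family.mk (fun N => N.1.op o (x ≫ (p N).hom)) (by
        obtain ⟨s, hs⟩ := Family.exists_term (e A x)
        exact ⟨.op o s, fun N => ⟨_, (hp N x).symm ▸ hs N, rfl⟩⟩)) }
  have hpM : ∀ N : { N // K N }, M.IsHom N.1 (p N) := fun N =>
    ⟨fun g => by simp [M, hp], fun o A x => by
      change (e _).symm _ ≫ _ = _
      rw [hp, Equiv.apply_symm_apply, Family.val_mk]⟩
  refine ⟨M, hK M fun x y h => hsep x y fun N => h N.1 (p N) N.2 (hpM N), fun N hN =>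
    ⟨p ⟨N, hN⟩, hpM ⟨N, hN⟩, fun f hf => ?_⟩⟩
  -- An arbitrary map of models `f` respects values of terms. In the cases `op`, `map` and `mul`,
  -- the values of a subterm in all models form a family, hence a point of `X`, and `hsep` exhibits
  -- `x` as the result of the operation on such points.
  have key : ∀ {A : C} (s : σ.Term A) (x : X.X.Point A),
      (∀ N : { N // K N }, N.1.Eval s (x ≫ (p N).hom)) → N.Eval s (x ≫ f.hom) := by
    intro A s
    induction s with
    | gen g =>
      intro x hx
      have : x = M.gen g := hsep _ _ fun N => (hx N).trans ((hpM N).gen g).symm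
      rw [this]
      exact hf.gen g
    | one =>
      intro x hx
      have : x = X.one := hsep _ _ fun N => Eq.trans (hx N) (p N).map_one.symm
      rw [this]
      exact f.map_one
    | op o s ih =>
      intro x hx
      choose φ h₁ h₂ using hx
      let y : X.X.Point _ := (e _).symm (Family.mk φ ⟨s, h₁⟩)
      have hy : ∀ N, y ≫ (p N).hom = φ N := fun N => by simp [y, hp]
      have : x = M.op o y := hsep _ _ fun N => by rw [h₂, (hpM N).op, hy]
      refine ⟨_, ih y fun N => (hy N).symm ▸ h₁ N, ?_⟩
      rw [this]
      exact hf.op o y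
    | map g s ih =>
      intro x hx
      choose φ h₁ h₂ using hx
      let y : X.X.Point _ := (e _).symm (Family.mk φ ⟨s, h₁⟩)
      have hy : ∀ N, y ≫ (p N).hom = φ N := fun N => by simp [y, hp]
      have : x = Ind.yoneda.map g ≫ y := hsep _ _ fun N => by rw [h₂, Category.assoc, hy]
      refine ⟨_, ih y fun N => (hy N).symm ▸ h₁ N, ?_⟩
      rw [this, Category.assoc]
    | mul s t ihs iht =>
      intro x hx
      choose φ ψ h₁ h₂ h₃ using hx
      let y : X.X.Point _ := (e _).symm (Family.mk φ ⟨s, h₁⟩)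
      let z : X.X.Point _ := (e _).symm (Family.mk ψ ⟨t, h₂⟩)
      have hy : ∀ N, y ≫ (p N).hom = φ N := fun N => by simp [y, hp]
      have hz : ∀ N, z ≫ (p N).hom = ψ N := fun N => by simp [z, hp]
      have : x = X.pmul y z := hsep _ _ fun N => by
        rw [h₃, IndAlg.pmul_comp_hom, hy, hz]
      refine ⟨_, _, ihs y fun N => (hy N).symm ▸ h₁ N, iht z fun N => (hz N).symm ▸ h₂ N, ?_⟩
      rw [this]
      exact IndAlg.pmul_comp_hom f y z
    | pair s t ihs iht =>
      intro x hx
      constructor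
      · rw [← Category.assoc]
        exact ihs _ fun N => by simpa using (hx N).1
      · rw [← Category.assoc]
        exact iht _ fun N => by simpa using (hx N).2
    | desc g h s ih =>
      intro x hx
      change N.Eval s _
      rw [← Category.assoc]
      exact ih _ fun N => by rw [Category.assoc]; exact hx N
  -- Every point of `X` is described by a term, whose value in `N` is both the image under `f` and
  -- the image under the evaluation map.
  refine IndAlg.hom_ext_points fun {A} x => ?_
  obtain ⟨s, hs⟩ := Family.exists_term (e A x)
  have h : ∀ N : { N // K N }, N.1.Eval s (x ≫ (p N).hom) := fun N => (hp N x).symm ▸ hs N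
  exact Eval.unique N (key s x h) (h ⟨N, hN⟩)

end Model

end OpSignature

/-! ### Prolongations of ind-objects through points -/

section Push

variable {k₀ : Type w} [CommRing k₀] {M : FormalMonoid.{u} k₀}
  {k : Type w} [Field k] [Algebra k₀ k]
  {C : Type u} [SmallCategory C] [Abelian C] [Linear k C] [MonoidalCategory C]
  [MonoidalPreadditive C] [MonoidalLinear k C] [RigidCategory C]

namespace ProlongationFunctor

variable (S : ProlongationFunctor M k C)

theorem tauι_map (i : M.I) {A B : C} (f : A ⟶ B) :
    S.tauι i A ≫ S.tau.map f = Ind.yoneda.map ((S.T i).map f) ≫ S.tauι i B :=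
  ι_colimMap (Functor.whiskerRight (S.τ.map f).nat Ind.yoneda) i

theorem trans_tauι {i j : M.I} (t : i ⟶ j) (A : C) :
    Ind.yoneda.map ((S.trans t).app A) ≫ S.tauι j A = S.tauι i A :=
  colimit.w ((S.τ.obj A).sys ⋙ Ind.yoneda) t

theorem tau_hom_ext {A : C} {Y : Ind C} {f g : S.tau.obj A ⟶ Y}
    (h : ∀ i, S.tauι i A ≫ f = S.tauι i A ≫ g) : f = g :=
  colimit.hom_ext h

theorem exists_tau_hom {A : C} {Y : Ind C} (φ : ∀ i, Y.Point ((S.T i).obj A))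
    (hφ : ∀ {i j : M.I} (t : i ⟶ j), Ind.yoneda.map ((S.trans t).app A) ≫ φ j = φ i) :
    ∃ f : S.tau.obj A ⟶ Y, ∀ i, S.tauι i A ≫ f = φ i :=
  ⟨colimit.desc ((S.τ.obj A).sys ⋙ Ind.yoneda) ⟨Y,
    { app := φ, naturality := fun _ _ t => (hφ t).trans (Category.comp_id _).symm }⟩,
    fun i => colimit.ι_desc _ i⟩

/-- Each `τ_i` is right exact, colimits of systems are computed levelwise, and `Ind.lim` preserves
finite colimits. This is what later makes `A ↦ Hom(τ A, B)` an ind-object. -/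
instance : PreservesFiniteColimits S.tau where
  preservesFiniteColimits J _ _ := by
    have : PreservesColimitsOfShape J (S.τ ⋙ Plng.toSys M k C) :=
      preservesColimitsOfShape_of_evaluation _ J fun i =>
        (S.right_exact i).preservesFiniteColimits J
    have : PreservesColimitsOfShape J ((S.τ ⋙ Plng.toSys M k C) ⋙ Ind.lim M.I) :=
      inferInstance
    exact this

/-- The morphism `τ A ⟶ τ X` induced by a point of `X` with values in `A`. -/
def tauPoint {A : C} {X : Ind C} (x : X.Point A) : S.tau.obj A ⟶ S.indTau.obj X :=
  Ind.lanι Ind.yoneda S.tau x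

theorem push_eq (i : M.I) {A : C} {X : Ind C} (x : X.Point A) :
    S.push i x = S.tauι i A ≫ S.tauPoint x :=
  congrArg (S.tauι i A ≫ ·) (Ind.unit_map _ _ x)

theorem tau_map_tauPoint {A B : C} {X : Ind C} (f : A ⟶ B) (x : X.Point B) :
    S.tau.map f ≫ S.tauPoint x = S.tauPoint (Ind.yoneda.map f ≫ x) :=
  Ind.map_lanι Ind.yoneda S.tau f x

theorem tauPoint_map {A : C} {X Y : Ind C} (x : X.Point A) (f : X ⟶ Y) :
    S.tauPoint x ≫ S.indTau.map f = S.tauPoint (x ≫ f) :=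
  Ind.lanι_map Ind.yoneda S.tau x f

theorem push_precomp (i : M.I) {A B : C} {X : Ind C} (f : A ⟶ B) (x : X.Point B) :
    S.push i (Ind.yoneda.map f ≫ x) = Ind.yoneda.map ((S.T i).map f) ≫ S.push i x := by
  rw [push_eq, push_eq, ← tau_map_tauPoint, ← Category.assoc, tauι_map, Category.assoc]

theorem push_map (i : M.I) {A : C} {X Y : Ind C} (x : X.Point A) (f : X ⟶ Y) :
    S.push i x ≫ S.indTau.map f = S.push i (x ≫ f) := by
  rw [push_eq, push_eq, Category.assoc, tauPoint_map]

theorem trans_push {i j : M.I} (t : i ⟶ j) {A : C} {X : Ind C} (x : X.Point A) :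
    Ind.yoneda.map ((S.trans t).app A) ≫ S.push j x = S.push i x := by
  rw [push_eq, push_eq, ← Category.assoc, trans_tauι]

theorem indTau_hom_ext {X Y : Ind C} {f g : S.indTau.obj X ⟶ Y}
    (h : ∀ (i) {A : C} (x : X.Point A), S.push i x ≫ f = S.push i x ≫ g) : f = g :=
  Ind.lan_hom_ext Ind.yoneda S.tau fun x => S.tau_hom_ext fun i => by
    have := h i x
    rw [push_eq, Category.assoc, Category.assoc] at this
    exact this

/-- `τ X` is a colimit over the points of `X` and then over the levels `i`; the hypotheses are
compatibility with the two kinds of transition maps. It turns operations on points into a structure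
map. -/
theorem exists_indTau_hom {X Y : Ind C} (φ : ∀ (i) (A : C), X.Point A → Y.Point ((S.T i).obj A))
    (hφ : ∀ (i) {A B : C} (f : A ⟶ B) (x : X.Point B),
      φ i A (Ind.yoneda.map f ≫ x) = Ind.yoneda.map ((S.T i).map f) ≫ φ i B x)
    (hφt : ∀ {i j : M.I} (t : i ⟶ j) {A : C} (x : X.Point A),
      Ind.yoneda.map ((S.trans t).app A) ≫ φ j A x = φ i A x) :
    ∃ d : S.indTau.obj X ⟶ Y, ∀ (i) {A : C} (x : X.Point A), S.push i x ≫ d = φ i A x := by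
  choose ψ hψ using fun (A : C) (x : X.Point A) =>
    S.exists_tau_hom (fun i => φ i A x) (fun t => hφt t x)
  obtain ⟨d, hd⟩ := Ind.exists_lan_hom Ind.yoneda S.tau (X := X) (Z := Y) ψ
    fun f x => S.tau_hom_ext fun i => by
      rw [hψ, hφ, ← Category.assoc, tauι_map, Category.assoc, hψ]
  refine ⟨d, fun i A x => ?_⟩
  rw [push_eq]
  exact (Category.assoc _ _ _).trans ((congrArg (S.tauι i A ≫ ·) (hd x)).trans (hψ A x i))

end ProlongationFunctor

end Push

/-! ### Free algebras with `E`-structure -/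

/-- The free commutative algebra on an object of `C`. -/
theorem IndAlg.exists_free {C : Type u} [SmallCategory C] [Abelian C] [MonoidalCategory C]
    [SymmetricCategory C] (V : C) :
    ∃ (A : IndAlg C) (s : A.X.Point V), ∀ (B : IndAlg C) (f : B.X.Point V),
      ∃! g : A ⟶ B, s ≫ g.hom = f := by
  -- A single constant of sort `V` and no operations: a model is an algebra with a morphism from
  -- `V`.
  let σ : OpSignature C := ⟨PUnit, fun _ => V, PEmpty, fun o _ => o.elim⟩
  obtain ⟨M, -, hM⟩ := OpSignature.Model.exists_initial (σ := σ) (fun _ => True)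
    fun _ _ => trivial
  refine ⟨M.alg, M.gen ⟨⟩, fun B f => ?_⟩
  obtain ⟨g, hg, huniq⟩ := hM ⟨B, fun _ => f, fun o => o.elim⟩ trivial
  exact ⟨g, hg.gen ⟨⟩, fun g' hg' => huniq g' ⟨fun _ => hg', fun o => o.elim⟩⟩

namespace EStructure

variable {k₀ : Type w} [CommRing k₀] {M : FormalMonoid.{u} k₀}
  {k : Type w} [Field k] [Algebra k₀ k]
  {C : Type u} [SmallCategory C] [Abelian C] [Linear k C] [MonoidalCategory C]
  [MonoidalPreadditive C] [MonoidalLinear k C] [RigidCategory C] [SymmetricCategory C]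
  {S : EStructure M k C}

open Functor.OplaxMonoidal in
/-- Operations `X(A) → X(τ_i A)` on the points of an algebra which amount to an `E`-structure. -/
structure IsPointAction (S : EStructure M k C) (X : IndAlg C)
    (φ : ∀ (i : M.I) {A : C}, X.X.Point A → X.X.Point ((S.T i).obj A)) : Prop where
  precomp : ∀ (i) {A B : C} (f : A ⟶ B) (x : X.X.Point B),
    φ i (Ind.yoneda.map f ≫ x) = Ind.yoneda.map ((S.T i).map f) ≫ φ i x
  trans : ∀ {i j : M.I} (t : i ⟶ j) {A : C} (x : X.X.Point A),
    Ind.yoneda.map ((S.trans t).app A) ≫ φ j x = φ i x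
  mul : ∀ (i) {A B : C} (x : X.X.Point A) (y : X.X.Point B),
    φ i (X.pmul x y) = Ind.yoneda.map (δ (S.T i) A B) ≫ X.pmul (φ i x) (φ i y)
  one : ∀ i, φ i X.one = Ind.yoneda.map (η (S.T i)) ≫ X.one
  base : ∀ {l : M.I} (g : M.E₀ l →ₐ[k₀] k₀) (hg : M.IsBase g) {A : C} (x : X.X.Point A),
    Ind.yoneda.map ((S.a g hg).app A) ≫ φ l x = x
  prod : ∀ {i j l : M.I} (f : M.E₀ l →ₐ[k₀] (M.E₀ i ⊗[k₀] M.E₀ j)) (hf : M.IsProd f) {A : C}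
    (x : X.X.Point A), φ i (φ j x) = Ind.yoneda.map ((S.b f hf).app A) ≫ φ l x

/-- Every axiom is an equation between two points, so it can be checked after maps that jointly
separate points and commute with the operations. -/
theorem IsPointAction.of_separated {X : IndAlg C}
    {φ : ∀ (i : M.I) {A : C}, X.X.Point A → X.X.Point ((S.T i).obj A)}
    (h : ∀ {A : C} (x y : X.X.Point A), (∀ (Y : IndAlg C)
      (ψ : ∀ (i : M.I) {A : C}, Y.X.Point A → Y.X.Point ((S.T i).obj A)) (f : X ⟶ Y),
      IsPointAction S Y ψ → (∀ (i) {A : C} (x : X.X.Point A), φ i x ≫ f.hom = ψ i (x ≫ f.hom)) →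
      x ≫ f.hom = y ≫ f.hom) → x = y) : IsPointAction S X φ where
  precomp i A B f x := h _ _ fun Y ψ p hψ hp => by
    rw [hp, Category.assoc, hψ.precomp, Category.assoc, hp]
  trans t A x := h _ _ fun Y ψ p hψ hp => by
    rw [hp, Category.assoc, hp, hψ.trans]
  mul i A B x y := h _ _ fun Y ψ p hψ hp => by
    rw [hp, IndAlg.pmul_comp_hom, hψ.mul, Category.assoc, IndAlg.pmul_comp_hom, hp, hp]
  one i := h _ _ fun Y ψ p hψ hp => by
    rw [hp, p.map_one, hψ.one, Category.assoc, p.map_one]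
  base g hg A x := h _ _ fun Y ψ p hψ hp => by
    rw [Category.assoc, hp, hψ.base]
  prod f hf A x := h _ _ fun Y ψ p hψ hp => by
    rw [hp, hp, Category.assoc, hp, hψ.prod f hf]

namespace EAlg

/-- The operation on points defined by an `E`-structure. -/
def act (B : S.EAlg) (i : M.I) {A : C} (x : B.alg.X.Point A) : B.alg.X.Point ((S.T i).obj A) :=
  S.push i x ≫ B.d

theorem isPointAction (B : S.EAlg) : IsPointAction S B.alg B.act where
  precomp i A A' f x := by simp only [act]; rw [S.push_precomp, Category.assoc]
  trans t A x := by simp only [act]; rw [← Category.assoc, S.trans_push]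
  mul i A A' x y := B.isAlgMap.map_mul i x y
  one i := B.isAlgMap.map_one i
  base g hg A x := B.d_a g hg x
  prod f hf A x := B.d_d f hf x

/-- An `E`-structure defined by operations on points. -/
def ofPoints (X : IndAlg C)
    (φ : ∀ (i : M.I) {A : C}, X.X.Point A → X.X.Point ((S.T i).obj A))
    (h : IsPointAction S X φ) : S.EAlg :=
  have hd := (S.exists_indTau_hom (fun i _ x => φ i x) h.precomp h.trans).choose_spec
  { alg := X
    d := (S.exists_indTau_hom (fun i _ x => φ i x) h.precomp h.trans).choose
    isAlgMap := ⟨fun i A A' x y => by rw [hd, hd, hd, h.mul], fun i => by rw [hd, h.one]⟩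
    d_a := fun g hg A x => by rw [hd, h.base]
    d_d := fun f hf A x => by rw [hd, hd, hd, h.prod f hf] }

theorem ofPoints_act (X : IndAlg C)
    (φ : ∀ (i : M.I) {A : C}, X.X.Point A → X.X.Point ((S.T i).obj A))
    (h : IsPointAction S X φ) (i : M.I) {A : C} (x : X.X.Point A) :
    (ofPoints X φ h).act i x = φ i x :=
  (S.exists_indTau_hom (fun i _ x => φ i x) h.precomp h.trans).choose_spec i x

theorem act_comp_hom {X Y : S.EAlg} (g : X ⟶ Y) (i : M.I) {A : C} (x : X.alg.X.Point A) :
    X.act i x ≫ g.hom.hom = Y.act i (x ≫ g.hom.hom) := by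
  simp only [act]
  rw [← S.push_map, Category.assoc, Category.assoc, g.comm]

/-- An algebra map which commutes with the operations on points preserves the `E`-structures. -/
def homMk {X Y : S.EAlg} (f : X.alg ⟶ Y.alg)
    (h : ∀ (i : M.I) {A : C} (x : X.alg.X.Point A),
      X.act i x ≫ f.hom = Y.act i (x ≫ f.hom)) : X ⟶ Y :=
  ⟨f, S.indTau_hom_ext fun i A x => by
    have := h i x
    simp only [act] at this
    rw [← S.push_map, Category.assoc, Category.assoc] at this
    exact this.symm⟩

/-- The initial model for constants indexed by the points of `W` and one operation for each level
`i`, in the class of models where the constants form an algebra map from `W` and the operations form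
a point action. -/
theorem exists_free (S : EStructure M k C) (W : IndAlg C) :
    ∃ (F : S.EAlg) (ε : W ⟶ F.alg), ∀ (B : S.EAlg) (f : W ⟶ B.alg),
      ∃! g : F ⟶ B, ε ≫ g.hom = f := by
  let σ : OpSignature C :=
    ⟨Σ A : C, W.X.Point A, Sigma.fst, M.I, fun i A => (S.T i).obj A⟩
  let K : σ.Model → Prop := fun N =>
    (∃ f : W ⟶ N.alg, ∀ (A : C) (x : W.X.Point A), x ≫ f.hom = N.gen ⟨A, x⟩) ∧
      IsPointAction S N.alg N.op
  -- Both conditions defining `K` are identities between points, so they are inherited by any model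
  -- separated by maps to members of `K`.
  obtain ⟨F, ⟨⟨ε, hε⟩, hF⟩, huniv⟩ := OpSignature.Model.exists_initial K (by
    intro N hN
    refine ⟨?_, IsPointAction.of_separated fun x y h => hN x y fun N' f hN' hf =>
      h _ N'.op f hN'.2 hf.op⟩
    refine IndAlg.exists_hom_of_points (fun A x => N.gen ⟨A, x⟩) (fun {A B} g x => ?_)
      (fun {A B} x y => ?_) ?_
    · refine hN _ _ fun N' f hN' hf => ?_
      obtain ⟨⟨p, hp⟩, -⟩ := hN'
      rw [hf.gen, Category.assoc, hf.gen, ← hp, ← hp, Category.assoc]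
    · refine hN _ _ fun N' f hN' hf => ?_
      obtain ⟨⟨p, hp⟩, -⟩ := hN'
      rw [hf.gen, IndAlg.pmul_comp_hom, hf.gen, hf.gen, ← hp, ← hp, ← hp, IndAlg.pmul_comp_hom]
    · refine hN _ _ fun N' f hN' hf => ?_
      obtain ⟨⟨p, hp⟩, -⟩ := hN'
      rw [hf.gen, ← hp, p.map_one, f.map_one])
  refine ⟨ofPoints F.alg F.op hF, ε, fun B f => ?_⟩
  obtain ⟨g, hg, hguniq⟩ := huniv ⟨B.alg, fun x => x.2 ≫ f.hom, B.act⟩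
    ⟨⟨f, fun A x => rfl⟩, B.isPointAction⟩
  refine ⟨homMk g fun i A x => ?_, IndAlg.hom_ext_points fun {A} x => ?_, fun g' hg' => ?_⟩
  · exact (congrArg (· ≫ g.hom) (ofPoints_act F.alg F.op hF i x)).trans (hg.op i x)
  · change x ≫ ε.hom ≫ g.hom = _
    rw [← Category.assoc, hε]
    exact hg.gen ⟨A, x⟩
  · refine EAlg.Hom.ext (hguniq g'.hom ⟨fun x => ?_, fun i A x => ?_⟩)
    · rw [← hε, Category.assoc]
      exact congrArg (fun h : W ⟶ B.alg => x.2 ≫ h.hom) hg'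
    · have := act_comp_hom g' i x
      rw [ofPoints_act] at this
      exact this

end EAlg

/-- The free algebra on `W` is an initial object of the category of arrows from `W` to the forgetful
functor. Passing to opposites gives the right adjoint on schemes. -/
instance forgetAlg_isRightAdjoint (S : EStructure M k C) : S.forgetAlg.IsRightAdjoint := by
  have : ∀ W : IndAlg C, HasInitial (StructuredArrow W S.forgetAlg) := by
    intro W
    obtain ⟨F, ε, h⟩ := EAlg.exists_free S W
    have hF : IsInitial (StructuredArrow.mk (Y := F) (T := S.forgetAlg) ε) :=
      IsInitial.ofUniqueHom
        (fun Y => StructuredArrow.homMk (h Y.right Y.hom).choose (h Y.right Y.hom).choose_spec.1)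
        (fun Y m => by
          ext
          exact (h Y.right Y.hom).choose_spec.2 _ (StructuredArrow.w m))
    exact hF.hasInitial
  exact isRightAdjointOfStructuredArrowInitials _

end EStructure

/-! ### Representatives of the unit and the product of a formal monoid -/

namespace FormalMonoid

variable {k₀ : Type w} [CommRing k₀] (M : FormalMonoid.{u} k₀)

theorem res_id (i : M.I) : M.res (𝟙 i) = AlgHom.id k₀ (M.E₀ i) := by
  simp [FormalSet.res]

theorem pt_comp_res {R : Type w} [CommRing R] [Algebra k₀ R] {l l' : M.I} (t : l ⟶ l')
    (f : M.E₀ l →ₐ[k₀] R) : M.pt (f.comp (M.res t)) = M.pt f :=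
  Quot.sound ⟨l', 𝟙 l', t, by rw [res_id, AlgHom.comp_id]⟩

theorem exists_isBase : ∃ (l : M.I) (g : M.E₀ l →ₐ[k₀] k₀), M.IsBase g := by
  obtain ⟨⟨l, g⟩, h⟩ := Quot.exists_rep (1 : M.Pt k₀)
  exact ⟨l, g, h⟩

theorem exists_isProd (i j : M.I) :
    ∃ (l : M.I) (f : M.E₀ l →ₐ[k₀] (M.E₀ i ⊗[k₀] M.E₀ j)), M.IsProd f := by
  obtain ⟨⟨l, g⟩, h⟩ := Quot.exists_rep
    (M.pt (Algebra.TensorProduct.includeRight : M.E₀ j →ₐ[k₀] (M.E₀ i ⊗[k₀] M.E₀ j)) *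
      M.pt (Algebra.TensorProduct.includeLeft : M.E₀ i →ₐ[k₀] (M.E₀ i ⊗[k₀] M.E₀ j)))
  exact ⟨l, g, h⟩

variable {M}

/-- The product of points is natural in the ring, and restriction of a tensor factor does not change
the point it represents. -/
theorem IsProd.map {i i' j j' l : M.I} (r : i ⟶ i') (s : j ⟶ j')
    {f : M.E₀ l →ₐ[k₀] (M.E₀ i' ⊗[k₀] M.E₀ j')} (hf : M.IsProd f) :
    M.IsProd ((Algebra.TensorProduct.map (M.res r) (M.res s)).comp f) := by
  have h := congrArg (M.mapPt (Algebra.TensorProduct.map (M.res r) (M.res s))) hf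
  rw [M.mapPt_mul] at h
  have h₁ : M.mapPt (Algebra.TensorProduct.map (M.res r) (M.res s))
      (M.pt (Algebra.TensorProduct.includeRight : M.E₀ j' →ₐ[k₀] (M.E₀ i' ⊗[k₀] M.E₀ j'))) =
      M.pt (Algebra.TensorProduct.includeRight : M.E₀ j →ₐ[k₀] (M.E₀ i ⊗[k₀] M.E₀ j)) := by
    rw [← M.pt_comp_res s]
    exact congrArg M.pt (Algebra.TensorProduct.map_comp_includeRight _ _)
  have h₂ : M.mapPt (Algebra.TensorProduct.map (M.res r) (M.res s))
      (M.pt (Algebra.TensorProduct.includeLeft : M.E₀ i' →ₐ[k₀] (M.E₀ i' ⊗[k₀] M.E₀ j'))) =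
      M.pt (Algebra.TensorProduct.includeLeft : M.E₀ i →ₐ[k₀] (M.E₀ i ⊗[k₀] M.E₀ j)) := by
    rw [← M.pt_comp_res r]
    exact congrArg M.pt (Algebra.TensorProduct.map_comp_includeLeft _ _)
  rw [h₁, h₂] at h
  exact h

/-- A function of the representatives of a point that is invariant under transition maps is
constant. -/
theorem eq_of_pt_eq {R : Type w} [CommRing R] [Algebra k₀ R] {α : Type*} {x : M.Pt R}
    (φ : ∀ {l : M.I} (f : M.E₀ l →ₐ[k₀] R), M.pt f = x → α)
    (hφ : ∀ {l l' : M.I} (t : l ⟶ l') (f : M.E₀ l →ₐ[k₀] R) (h : M.pt f = x)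
      (h' : M.pt (f.comp (M.res t)) = x), φ f h = φ (f.comp (M.res t)) h')
    {l l' : M.I} (f : M.E₀ l →ₐ[k₀] R) (f' : M.E₀ l' →ₐ[k₀] R) (h : M.pt f = x)
    (h' : M.pt f' = x) : φ f h = φ f' h' := by
  -- Equality in the quotient is the equivalence relation generated by `PtRel`, so the invariance is
  -- propagated along chains.
  have key : ∀ p q : M.PreResPt R, Relation.EqvGen (M.PtRel R) p q →
      ∀ (hp : M.pt p.2 = x) (hq : M.pt q.2 = x), φ p.2 hp = φ q.2 hq := by
    intro p q hpq
    induction hpq with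
    | rel p q hr =>
      intro hp hq
      obtain ⟨n, s, t, hst⟩ := hr
      rw [hφ s p.2 hp ((M.pt_comp_res s p.2).trans hp),
        hφ t q.2 hq ((M.pt_comp_res t q.2).trans hq)]
      congr 1
    | refl p => intro _ _; rfl
    | symm p q _ ih => intro hp hq; exact (ih hq hp).symm
    | trans p q r hpq _ ih₁ ih₂ =>
      intro hp hr
      have hq : M.pt q.2 = x := (Quot.eqvGen_sound hpq).symm.trans hp
      exact (ih₁ hp hq).trans (ih₂ hq hr)
  exact key ⟨l, f⟩ ⟨l', f'⟩ (Quot.eqvGen_exact (h.trans h'.symm)) h h'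

end FormalMonoid

namespace ProlongationFunctor

variable {k₀ : Type w} [CommRing k₀] {M : FormalMonoid.{u} k₀}
  {k : Type w} [Field k] [Algebra k₀ k]
  {C : Type u} [SmallCategory C] [Abelian C] [Linear k C] [MonoidalCategory C]
  [MonoidalPreadditive C] [MonoidalLinear k C] [RigidCategory C] (S : ProlongationFunctor M k C)

theorem trans_id (i : M.I) : S.trans (𝟙 i) = 𝟙 (S.T i) := by
  ext A
  exact (S.τ.obj A).sys.map_id i

end ProlongationFunctor

/-! ### The maps `A ⟶ τ A` and `τ τ_i A ⟶ τ A` -/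

namespace EStructure

variable {k₀ : Type w} [CommRing k₀] {M : FormalMonoid.{u} k₀}
  {k : Type w} [Field k] [Algebra k₀ k]
  {C : Type u} [SmallCategory C] [Abelian C] [Linear k C] [MonoidalCategory C]
  [MonoidalPreadditive C] [MonoidalLinear k C] [RigidCategory C] [SymmetricCategory C]
  (S : EStructure M k C)

theorem exists_baseMap (A : C) : ∃ β : S.tau.obj A |>.Point A,
    ∀ {l : M.I} (g : M.E₀ l →ₐ[k₀] k₀) (hg : M.IsBase g),
      Ind.yoneda.map ((S.a g hg).app A) ≫ S.tauι l A = β := by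
  obtain ⟨l₀, g₀, h₀⟩ := M.exists_isBase
  refine ⟨Ind.yoneda.map ((S.a g₀ h₀).app A) ≫ S.tauι l₀ A, fun g hg => ?_⟩
  refine FormalMonoid.eq_of_pt_eq (x := 1)
    (fun {l} g hg => Ind.yoneda.map ((S.a g hg).app A) ≫ S.tauι l A) (fun t f h h' => ?_) _ _ _ _
  rw [← S.a_trans t f _ h h' rfl, NatTrans.comp_app, Functor.map_comp, Category.assoc,
    S.trans_tauι]

/-- The natural map `a : A ⟶ τ A`. -/
def baseMap (A : C) : (S.tau.obj A).Point A := (S.exists_baseMap A).choose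

theorem a_tauι {l : M.I} (g : M.E₀ l →ₐ[k₀] k₀) (hg : M.IsBase g) (A : C) :
    Ind.yoneda.map ((S.a g hg).app A) ≫ S.tauι l A = S.baseMap A :=
  (S.exists_baseMap A).choose_spec g hg

theorem baseMap_naturality {A B : C} (f : A ⟶ B) :
    Ind.yoneda.map f ≫ S.baseMap B = S.baseMap A ≫ S.tau.map f := by
  obtain ⟨l, g, hg⟩ := M.exists_isBase
  rw [← S.a_tauι g hg, ← S.a_tauι g hg, Category.assoc, S.tauι_map, ← Category.assoc,
    ← Category.assoc, ← Functor.map_comp, ← Functor.map_comp]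
  congr 2
  exact (S.a g hg).naturality f

theorem b_tauι_eq {i j l l' : M.I} (f : M.E₀ l →ₐ[k₀] (M.E₀ i ⊗[k₀] M.E₀ j))
    (f' : M.E₀ l' →ₐ[k₀] (M.E₀ i ⊗[k₀] M.E₀ j)) (hf : M.IsProd f) (hf' : M.IsProd f') (A : C) :
    Ind.yoneda.map ((S.b f hf).app A) ≫ S.tauι l A =
      Ind.yoneda.map ((S.b f' hf').app A) ≫ S.tauι l' A := by
  refine FormalMonoid.eq_of_pt_eq
    (fun {l} f hf => Ind.yoneda.map ((S.b f hf).app A) ≫ S.tauι l A) (fun t f h h' => ?_) _ _ _ _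
  -- Identity transitions on the two factors isolate the dependence on the representative of the
  -- product.
  have := S.b_trans (𝟙 i) (𝟙 j) t f (f.comp (M.res t)) h h' (by
    rw [M.res_id, M.res_id, Algebra.TensorProduct.map_id, AlgHom.id_comp]) A
  rw [S.trans_id, S.trans_id, NatTrans.id_app, NatTrans.id_app, CategoryTheory.Functor.map_id,
    Category.id_comp, Category.id_comp] at this
  rw [← this, Functor.map_comp, Category.assoc, S.trans_tauι]

/-- Restriction of the factors of a product. -/
theorem map_b_tauι {i i' j j' l l' : M.I} (r : i ⟶ i') (s : j ⟶ j')
    (f : M.E₀ l →ₐ[k₀] (M.E₀ i ⊗[k₀] M.E₀ j)) (hf : M.IsProd f)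
    (f' : M.E₀ l' →ₐ[k₀] (M.E₀ i' ⊗[k₀] M.E₀ j')) (hf' : M.IsProd f') (A : C) :
    Ind.yoneda.map ((S.T i).map ((S.trans s).app A) ≫ (S.trans r).app ((S.T j').obj A) ≫
      (S.b f' hf').app A) ≫ S.tauι l' A = Ind.yoneda.map ((S.b f hf).app A) ≫ S.tauι l A := by
  rw [← S.b_trans r s (𝟙 l') _ f' (hf'.map r s) hf' (by rw [M.res_id, AlgHom.comp_id]) A,
    S.trans_id, NatTrans.id_app, Category.comp_id]
  exact S.b_tauι_eq _ _ _ _ _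

/-- For fixed inner level `i`, the maps `b` into `τ A` are independent of representatives by
`b_tauι_eq` and compatible in the outer level `j` by `map_b_tauι`, so they glue. -/
theorem exists_mulMap (i : M.I) (A : C) : ∃ μ : S.tau.obj ((S.T i).obj A) ⟶ S.tau.obj A,
    ∀ {j l : M.I} (f : M.E₀ l →ₐ[k₀] (M.E₀ j ⊗[k₀] M.E₀ i)) (hf : M.IsProd f),
      S.tauι j ((S.T i).obj A) ≫ μ = Ind.yoneda.map ((S.b f hf).app A) ≫ S.tauι l A := by
  choose n f hf using fun j => M.exists_isProd j i
  obtain ⟨μ, hμ⟩ := S.exists_tau_hom (A := (S.T i).obj A)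
    (fun j => Ind.yoneda.map ((S.b (f j) (hf j)).app A) ≫ S.tauι (n j) A) (fun {j j'} t => by
      rw [← S.map_b_tauι t (𝟙 i) (f j) (hf j) (f j') (hf j'), S.trans_id, NatTrans.id_app,
        CategoryTheory.Functor.map_id, Category.id_comp, Functor.map_comp, Category.assoc])
  exact ⟨μ, fun g hg => (hμ _).trans (S.b_tauι_eq _ _ _ _ _)⟩

/-- The component `τ τ_i A ⟶ τ A` of the natural map `τ τ A ⟶ m^! τ A ⟶ τ A`. -/
def mulMap (i : M.I) (A : C) : S.tau.obj ((S.T i).obj A) ⟶ S.tau.obj A :=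
  (S.exists_mulMap i A).choose

theorem tauι_mulMap {i j l : M.I} (f : M.E₀ l →ₐ[k₀] (M.E₀ j ⊗[k₀] M.E₀ i)) (hf : M.IsProd f)
    (A : C) : S.tauι j ((S.T i).obj A) ≫ S.mulMap i A =
      Ind.yoneda.map ((S.b f hf).app A) ≫ S.tauι l A :=
  (S.exists_mulMap i A).choose_spec f hf

theorem mulMap_naturality (i : M.I) {A B : C} (f : A ⟶ B) :
    S.tau.map ((S.T i).map f) ≫ S.mulMap i B = S.mulMap i A ≫ S.tau.map f := by
  refine S.tau_hom_ext fun j => ?_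
  obtain ⟨l, p, hp⟩ := M.exists_isProd j i
  rw [← Category.assoc, S.tauι_map, Category.assoc, S.tauι_mulMap p hp, ← Category.assoc,
    ← Category.assoc, S.tauι_mulMap p hp, Category.assoc, Category.assoc, S.tauι_map,
    ← Category.assoc, ← Category.assoc, ← Functor.map_comp, ← Functor.map_comp]
  congr 2
  exact (S.b p hp).naturality f

theorem trans_mulMap {i i' : M.I} (t : i ⟶ i') (A : C) :
    S.tau.map ((S.trans t).app A) ≫ S.mulMap i' A = S.mulMap i A := by
  refine S.tau_hom_ext fun j => ?_
  obtain ⟨l, p, hp⟩ := M.exists_isProd j i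
  obtain ⟨l', p', hp'⟩ := M.exists_isProd j i'
  rw [← Category.assoc, S.tauι_map, Category.assoc, S.tauι_mulMap p' hp', S.tauι_mulMap p hp,
    ← S.map_b_tauι (𝟙 j) t p hp p' hp', S.trans_id, NatTrans.id_app, Category.id_comp,
    Functor.map_comp, Category.assoc]

namespace IsCoherent

variable {S}

theorem baseMap_mulMap (hS : S.IsCoherent) (i : M.I) (A : C) :
    S.baseMap ((S.T i).obj A) ≫ S.mulMap i A = S.tauι i A := by
  obtain ⟨l, g, hg⟩ := M.exists_isBase
  obtain ⟨n, p, hp⟩ := M.exists_isProd l i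
  rw [← S.a_tauι g hg, Category.assoc, S.tauι_mulMap p hp, ← Category.assoc, ← Functor.map_comp]
  exact hS.left_unit p hp g hg A

theorem a_mulMap (hS : S.IsCoherent) {l : M.I} (g : M.E₀ l →ₐ[k₀] k₀) (hg : M.IsBase g) (A : C) :
    S.tau.map ((S.a g hg).app A) ≫ S.mulMap l A = 𝟙 (S.tau.obj A) := by
  refine S.tau_hom_ext fun j => ?_
  obtain ⟨n, p, hp⟩ := M.exists_isProd j l
  rw [← Category.assoc, S.tauι_map, Category.assoc, S.tauι_mulMap p hp, ← Category.assoc,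
    ← Functor.map_comp]
  exact (hS.right_unit p hp g hg A).trans (Category.comp_id _).symm

/-- The associativity law of the monad, on the component `τ τ_i τ_j A ⟶ τ A`. -/
theorem mulMap_mulMap (hS : S.IsCoherent) {i j l : M.I}
    (f : M.E₀ l →ₐ[k₀] (M.E₀ i ⊗[k₀] M.E₀ j)) (hf : M.IsProd f) (A : C) :
    S.mulMap i ((S.T j).obj A) ≫ S.mulMap j A =
      S.tau.map ((S.b f hf).app A) ≫ S.mulMap l A := by
  refine S.tau_hom_ext fun n => ?_
  obtain ⟨r, p, hp⟩ := M.exists_isProd n l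
  obtain ⟨n', f', hf'⟩ := M.exists_isProd n i
  obtain ⟨r', p', hp'⟩ := M.exists_isProd n' j
  have h := hS.assoc f hf p hp f' hf' p' hp' A
  rw [Functor.map_comp, Functor.map_comp, Category.assoc, Category.assoc] at h
  rw [← Category.assoc, S.tauι_mulMap f' hf', Category.assoc, S.tauι_mulMap p' hp',
    ← Category.assoc, ← Category.assoc, S.tauι_map, Category.assoc, Category.assoc,
    S.tauι_mulMap p hp]
  exact h.symm

end IsCoherent

end EStructure

/-! ### The right adjoint of the prolongation on algebras -/

namespace IndAlg

variable {C : Type u} [SmallCategory C] [Abelian C] [MonoidalCategory C] [SymmetricCategory C]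
  (X : IndAlg C)

theorem pmul_precomp_left {A A' B : C} (f : A ⟶ A') (x : X.X.Point A') (y : X.X.Point B) :
    X.pmul (Ind.yoneda.map f ≫ x) y = Ind.yoneda.map (f ▷ B) ≫ X.pmul x y := by
  simpa using X.pmul_precomp f (𝟙 B) x y

theorem pmul_precomp_right {A B B' : C} (g : B ⟶ B') (x : X.X.Point A) (y : X.X.Point B') :
    X.pmul x (Ind.yoneda.map g ≫ y) = Ind.yoneda.map (A ◁ g) ≫ X.pmul x y := by
  simpa using X.pmul_precomp (𝟙 A) g x y

theorem pmul_assoc {A₁ A₂ A₃ : C} (x : X.X.Point A₁) (y : X.X.Point A₂) (z : X.X.Point A₃) :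
    X.pmul (X.pmul x y) z = Ind.yoneda.map (α_ A₁ A₂ A₃).hom ≫ X.pmul x (X.pmul y z) :=
  X.assoc x y z

theorem one_pmul {A : C} (x : X.X.Point A) : X.pmul X.one x = Ind.yoneda.map (λ_ A).hom ≫ x :=
  X.one_mul x

theorem pmul_comm {A B : C} (x : X.X.Point A) (y : X.X.Point B) :
    X.pmul x y = Ind.yoneda.map (β_ A B).hom ≫ X.pmul y x :=
  X.comm x y

end IndAlg

namespace TensorProlongationFunctor

open Functor.OplaxMonoidal

variable {k₀ : Type w} [CommRing k₀] {M : FormalMonoid.{u} k₀}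
  {k : Type w} [Field k] [Algebra k₀ k]
  {C : Type u} [SmallCategory C] [Abelian C] [Linear k C] [MonoidalCategory C]
  [MonoidalPreadditive C] [MonoidalLinear k C] [RigidCategory C] [SymmetricCategory C]
  (S : TensorProlongationFunctor M k C)

/-- The levelwise products, pulled back along `δ`, are compatible because `δ` commutes with the
transition maps. They will be the multiplication on the presheaf `A ↦ Hom(τ A, B)`. -/
theorem exists_tauMul (B : IndAlg C) {A A' : C} (x : S.tau.obj A ⟶ B.X) (y : S.tau.obj A' ⟶ B.X) :
    ∃ z : S.tau.obj (A ⊗ A') ⟶ B.X, ∀ i, S.tauι i (A ⊗ A') ≫ z =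
      Ind.yoneda.map (δ (S.T i) A A') ≫ B.pmul (S.tauι i A ≫ x) (S.tauι i A' ≫ y) :=
  S.exists_tau_hom _ fun {i j} t => by
    rw [← S.trans_tauι t A, ← S.trans_tauι t A', Category.assoc, Category.assoc, B.pmul_precomp,
      ← Category.assoc, ← Category.assoc, ← Functor.map_comp, ← Functor.map_comp]
    exact congrArg (fun f => Ind.yoneda.map f ≫ _) (S.δ_trans t A A')

/-- The product of two morphisms from prolongations of objects of `C` to an algebra. -/
def tauMul (B : IndAlg C) {A A' : C} (x : S.tau.obj A ⟶ B.X) (y : S.tau.obj A' ⟶ B.X) :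
    S.tau.obj (A ⊗ A') ⟶ B.X :=
  (S.exists_tauMul B x y).choose

theorem tauι_tauMul (B : IndAlg C) {A A' : C} (x : S.tau.obj A ⟶ B.X) (y : S.tau.obj A' ⟶ B.X)
    (i : M.I) : S.tauι i (A ⊗ A') ≫ S.tauMul B x y =
      Ind.yoneda.map (δ (S.T i) A A') ≫ B.pmul (S.tauι i A ≫ x) (S.tauι i A' ≫ y) :=
  (S.exists_tauMul B x y).choose_spec i

theorem exists_tauOne (B : IndAlg C) :
    ∃ z : S.tau.obj (𝟙_ C) ⟶ B.X, ∀ i, S.tauι i (𝟙_ C) ≫ z =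
      Ind.yoneda.map (η (S.T i)) ≫ B.one :=
  S.exists_tau_hom _ fun {i j} t => by
    rw [← Category.assoc, ← Functor.map_comp]
    exact congrArg (fun f => Ind.yoneda.map f ≫ _) (S.η_trans t)

/-- The unit `τ 𝟙 ⟶ B` of an algebra. -/
def tauOne (B : IndAlg C) : S.tau.obj (𝟙_ C) ⟶ B.X := (S.exists_tauOne B).choose

theorem tauι_tauOne (B : IndAlg C) (i : M.I) :
    S.tauι i (𝟙_ C) ≫ S.tauOne B = Ind.yoneda.map (η (S.T i)) ≫ B.one :=
  (S.exists_tauOne B).choose_spec i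

theorem tauMul_precomp (B : IndAlg C) {A A' D D' : C} (f : A ⟶ A') (g : D ⟶ D')
    (x : S.tau.obj A' ⟶ B.X) (y : S.tau.obj D' ⟶ B.X) :
    S.tauMul B (S.tau.map f ≫ x) (S.tau.map g ≫ y) = S.tau.map (f ⊗ₘ g) ≫ S.tauMul B x y := by
  refine S.tau_hom_ext fun i => ?_
  rw [S.tauι_tauMul, ← Category.assoc, S.tauι_map, ← Category.assoc, S.tauι_map, ← Category.assoc,
    S.tauι_map, Category.assoc, Category.assoc, Category.assoc, S.tauι_tauMul, B.pmul_precomp,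
    ← Category.assoc, ← Category.assoc, ← Functor.map_comp, ← Functor.map_comp, δ_natural]

theorem tauMul_assoc (B : IndAlg C) {A₁ A₂ A₃ : C} (x : S.tau.obj A₁ ⟶ B.X)
    (y : S.tau.obj A₂ ⟶ B.X) (z : S.tau.obj A₃ ⟶ B.X) :
    S.tauMul B (S.tauMul B x y) z =
      S.tau.map (α_ A₁ A₂ A₃).hom ≫ S.tauMul B x (S.tauMul B y z) := by
  refine S.tau_hom_ext fun i => ?_
  rw [S.tauι_tauMul, S.tauι_tauMul, ← Category.assoc, S.tauι_map, Category.assoc, S.tauι_tauMul,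
    S.tauι_tauMul, B.pmul_precomp_left, B.pmul_precomp_right, B.pmul_assoc]
  simp only [← Category.assoc, ← Functor.map_comp]
  congr 2
  simpa using associativity (S.T i) A₁ A₂ A₃

theorem tauOne_tauMul (B : IndAlg C) {A : C} (x : S.tau.obj A ⟶ B.X) :
    S.tauMul B (S.tauOne B) x = S.tau.map (λ_ A).hom ≫ x := by
  refine S.tau_hom_ext fun i => ?_
  rw [S.tauι_tauMul, S.tauι_tauOne, ← Category.assoc (S.tauι _ _) (S.tau.map _), S.tauι_map,
    B.pmul_precomp_left, B.one_pmul]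
  simp only [← Category.assoc, ← Functor.map_comp]
  congr 3
  simpa using left_unitality_hom (S.T i) A

theorem tauMul_comm (B : IndAlg C) {A A' : C} (x : S.tau.obj A ⟶ B.X) (y : S.tau.obj A' ⟶ B.X) :
    S.tauMul B x y = S.tau.map (β_ A A').hom ≫ S.tauMul B y x := by
  refine S.tau_hom_ext fun i => ?_
  rw [S.tauι_tauMul, ← Category.assoc, S.tauι_map, Category.assoc, S.tauι_tauMul, B.pmul_comm]
  simp only [← Category.assoc, ← Functor.map_comp]
  rw [S.δ_braiding]

variable {S} in
theorem IsAlgMap.comp {W B B' : IndAlg C} {t : S.indTau.obj W.X ⟶ B.X} (ht : S.IsAlgMap W B t)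
    (g : B ⟶ B') : S.IsAlgMap W B' (t ≫ g.hom) where
  map_mul i A A' x y := by
    rw [← Category.assoc, ht.map_mul, Category.assoc, IndAlg.pmul_comp_hom, Category.assoc,
      Category.assoc]
  map_one i := by rw [← Category.assoc, ht.map_one, Category.assoc, g.map_one]

variable {S} in
theorem IsAlgMap.precomp {W W' B : IndAlg C} {t : S.indTau.obj W'.X ⟶ B.X}
    (ht : S.IsAlgMap W' B t) (f : W ⟶ W') : S.IsAlgMap W B (S.indTau.map f.hom ≫ t) where
  map_mul i A A' x y := by
    simp only [← Category.assoc, S.push_map]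
    rw [IndAlg.pmul_comp_hom, ht.map_mul]
  map_one i := by
    rw [← Category.assoc, S.push_map, f.map_one, ht.map_one]

/-- The algebra whose points with values in `A` are the morphisms `τ A ⟶ B`. -/
theorem exists_coprolongation (B : IndAlg C) :
    ∃ (X : IndAlg C) (e : ∀ A, X.X.Point A ≃ (S.tau.obj A ⟶ B.X)),
      (∀ {A A' : C} (f : A ⟶ A') (x : X.X.Point A'),
        e A (Ind.yoneda.map f ≫ x) = S.tau.map f ≫ e A' x) ∧
      (∀ {A A' : C} (x : X.X.Point A) (y : X.X.Point A'),
        e _ (X.pmul x y) = S.tauMul B (e A x) (e A' y)) ∧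
      e _ X.one = S.tauOne B :=
  IndAlg.exists_of_presheaf (fun A => S.tau.obj A ⟶ B.X) (fun f x => S.tau.map f ≫ x)
    (S.tauMul B) (S.tauOne B) (fun x => by simp) (fun f g x => by simp)
    (fun x y => by
      obtain ⟨z, h₁, h₂⟩ := Ind.exists_map_coprod S.tau x y
      exact ⟨_, _, _, z, h₁, h₂⟩)
    (fun f g y h => by
      obtain ⟨z, hz⟩ := Ind.exists_map_coequalizer S.tau f g y h
      exact ⟨_, _, z, hz, coequalizer.condition f g⟩)
    (S.tauMul_precomp B) (S.tauMul_assoc B) (S.tauOne_tauMul B) (S.tauMul_comm B)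

end TensorProlongationFunctor

/-! ### Cofree algebras and the universal algebra map -/

namespace EStructure

open Functor.OplaxMonoidal

variable {k₀ : Type w} [CommRing k₀] {M : FormalMonoid.{u} k₀}
  {k : Type w} [Field k] [Algebra k₀ k]
  {C : Type u} [SmallCategory C] [Abelian C] [Linear k C] [MonoidalCategory C]
  [MonoidalPreadditive C] [MonoidalLinear k C] [RigidCategory C] [SymmetricCategory C]
  (S : EStructure M k C)

theorem baseMap_tauMul (B : IndAlg C) {A A' : C} (x : S.tau.obj A ⟶ B.X)
    (y : S.tau.obj A' ⟶ B.X) :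
    S.baseMap (A ⊗ A') ≫ S.tauMul B x y = B.pmul (S.baseMap A ≫ x) (S.baseMap A' ≫ y) := by
  obtain ⟨l, g, hg⟩ := M.exists_isBase
  rw [← S.a_tauι g hg, ← S.a_tauι g hg, ← S.a_tauι g hg, Category.assoc, S.tauι_tauMul,
    Category.assoc, Category.assoc, B.pmul_precomp, ← Category.assoc, ← Functor.map_comp,
    S.a_tensor]

theorem baseMap_tauOne (B : IndAlg C) : S.baseMap (𝟙_ C) ≫ S.tauOne B = B.one := by
  obtain ⟨l, g, hg⟩ := M.exists_isBase
  rw [← S.a_tauι g hg, Category.assoc, S.tauι_tauOne, ← Category.assoc, ← Functor.map_comp,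
    S.a_unit]
  exact (congrArg (· ≫ B.one) (Ind.yoneda.map_id _)).trans (Category.id_comp _)

/-- This is `b_tensor` after passing to the colimit; it makes the action on the cofree algebra
multiplicative. -/
theorem mulMap_tauMul (B : IndAlg C) (i : M.I) {A A' : C} (x : S.tau.obj A ⟶ B.X)
    (y : S.tau.obj A' ⟶ B.X) :
    S.mulMap i (A ⊗ A') ≫ S.tauMul B x y =
      S.tau.map (δ (S.T i) A A') ≫ S.tauMul B (S.mulMap i A ≫ x) (S.mulMap i A' ≫ y) := by
  refine S.tau_hom_ext fun j => ?_
  obtain ⟨l, f, hf⟩ := M.exists_isProd j i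
  rw [← Category.assoc, S.tauι_mulMap f hf, Category.assoc, S.tauι_tauMul, ← Category.assoc,
    ← Functor.map_comp, S.b_tensor, ← Category.assoc (S.tauι _ _) (S.tau.map _), S.tauι_map,
    Category.assoc, S.tauι_tauMul, ← Category.assoc (S.tauι _ _) (S.mulMap _ _),
    ← Category.assoc (S.tauι _ _) (S.mulMap _ _), S.tauι_mulMap f hf, S.tauι_mulMap f hf,
    Category.assoc, Category.assoc, B.pmul_precomp, Functor.map_comp, Functor.map_comp,
    Category.assoc, Category.assoc]

theorem mulMap_tauOne (B : IndAlg C) (i : M.I) :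
    S.mulMap i (𝟙_ C) ≫ S.tauOne B = S.tau.map (η (S.T i)) ≫ S.tauOne B := by
  refine S.tau_hom_ext fun j => ?_
  obtain ⟨l, f, hf⟩ := M.exists_isProd j i
  rw [← Category.assoc, S.tauι_mulMap f hf, Category.assoc, S.tauι_tauOne, ← Category.assoc,
    ← Functor.map_comp, S.b_unit, ← Category.assoc, S.tauι_map, Category.assoc, S.tauι_tauOne,
    Functor.map_comp, Category.assoc]

/-- For a coherent `E`-structure, every algebra `B` has a cofree algebra with `E`-structure `F`,
and algebra maps `τ W ⟶ B` are the same as algebra maps `W ⟶ F`. -/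
theorem IsCoherent.exists_cofree {S : EStructure M k C} (hS : S.IsCoherent) (B : IndAlg C) :
    ∃ (F : S.EAlg) (ε : F.alg ⟶ B),
      (∀ (X : S.EAlg) (g : X.alg ⟶ B), ∃ h : X ⟶ F, h.hom ≫ ε = g) ∧
      ∀ (W : IndAlg C) (s : S.indTau.obj W.X ⟶ B.X), S.IsAlgMap W B s →
        ∃! v : W ⟶ F.alg, ∀ (i : M.I) {A : C} (x : W.X.Point A),
          F.act i (x ≫ v.hom) ≫ ε.hom = S.push i x ≫ s := by
  obtain ⟨X, e, he, hmul, hone⟩ := S.exists_coprolongation B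
  -- A point `τ A ⟶ B` is sent to `τ τ_i A ⟶ τ A ⟶ B`. The axiom `base` is the right unit law of the
  -- monad and `prod` is its associativity.
  let F : S.EAlg := EAlg.ofPoints X (fun i A x => (e _).symm (S.mulMap i A ≫ e A x))
    { precomp := fun i A A' f x => (e _).injective (by
        rw [he, he, Equiv.apply_symm_apply, Equiv.apply_symm_apply, ← Category.assoc,
          ← Category.assoc, S.mulMap_naturality])
      trans := fun {i j} t A x => (e _).injective (by
        rw [he, Equiv.apply_symm_apply, Equiv.apply_symm_apply, ← Category.assoc, S.trans_mulMap])
      mul := fun i A A' x y => (e _).injective (by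
        rw [he, hmul, hmul, Equiv.apply_symm_apply, Equiv.apply_symm_apply,
          Equiv.apply_symm_apply, S.mulMap_tauMul])
      one := fun i => (e _).injective (by
        rw [he, hone, Equiv.apply_symm_apply, S.mulMap_tauOne])
      base := fun g hg A x => (e _).injective (by
        rw [he, Equiv.apply_symm_apply, ← Category.assoc]
        exact (congrArg (· ≫ e A x) (hS.a_mulMap g hg A)).trans (Category.id_comp _))
      prod := fun {i j l} f hf A x => (e _).injective (by
        rw [he, Equiv.apply_symm_apply, Equiv.apply_symm_apply, Equiv.apply_symm_apply,
          ← Category.assoc, ← Category.assoc, hS.mulMap_mulMap f hf]) }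
  have hF : ∀ (i : M.I) {A : C} (x : X.X.Point A), e _ (F.act i x) = S.mulMap i A ≫ e A x :=
    fun i A x => by
      refine (congrArg (e _) (EAlg.ofPoints_act _ _ _ i x)).trans ?_
      rw [Equiv.apply_symm_apply]
  obtain ⟨ε, hε⟩ : ∃ ε : X ⟶ B, ∀ {A : C} (x : X.X.Point A), x ≫ ε.hom = S.baseMap A ≫ e A x :=
    IndAlg.exists_hom_of_points (fun A x => S.baseMap A ≫ e A x)
      (fun f x => by rw [he, ← Category.assoc, ← S.baseMap_naturality, Category.assoc])
      (fun x y => by rw [hmul, S.baseMap_tauMul])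
      (by rw [hone, S.baseMap_tauOne])
  -- By the left unit law, acting on a point of `X` and then applying `ε` returns the components of
  -- the morphism `τ A ⟶ B` that it stands for. Uniqueness of `v` below rests on this.
  have hact : ∀ (i : M.I) {A : C} (x : X.X.Point A), F.act i x ≫ ε.hom = S.tauι i A ≫ e A x :=
    fun i A x => by
      refine (hε _).trans ?_
      rw [hF, ← Category.assoc, hS.baseMap_mulMap]
  -- A point `x` of `W` goes to the composite `τ A ⟶ τ W ⟶ B`; this respects products and units
  -- because `s` is an algebra map.
  have hlift : ∀ (W : IndAlg C) (s : S.indTau.obj W.X ⟶ B.X), S.IsAlgMap W B s →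
      ∃ v : W ⟶ X, ∀ (i : M.I) {A : C} (x : W.X.Point A),
        S.tauι i A ≫ e A (x ≫ v.hom) = S.push i x ≫ s := by
    intro W s hs
    have hpush : ∀ (i : M.I) {A : C} (x : W.X.Point A),
        S.tauι i A ≫ S.tauPoint x ≫ s = S.push i x ≫ s := fun i A x => by
      rw [← Category.assoc, S.push_eq]
    obtain ⟨v, hv⟩ := IndAlg.exists_hom_of_points (X := W) (Y := X)
      (fun A x => (e A).symm (S.tauPoint x ≫ s))
      (fun f x => (e _).injective (by
        rw [he, Equiv.apply_symm_apply, Equiv.apply_symm_apply, ← Category.assoc,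
          S.tau_map_tauPoint]))
      (fun x y => (e _).injective (S.tau_hom_ext fun i => by
        rw [hmul, Equiv.apply_symm_apply, Equiv.apply_symm_apply, Equiv.apply_symm_apply,
          S.tauι_tauMul, hpush, hpush, hpush, hs.map_mul]))
      ((e _).injective (S.tau_hom_ext fun i => by
        rw [hone, Equiv.apply_symm_apply, S.tauι_tauOne, hpush, hs.map_one]))
    exact ⟨v, fun i A x => by rw [hv, Equiv.apply_symm_apply, hpush]⟩
  refine ⟨F, ε, fun Y g => ?_, fun W s hs => ?_⟩
  -- The lift of `g` corresponds to `τ Y ⟶ Y ⟶ B`. It preserves the `E`-structures by the axiom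
  -- `prod` of `Y`, and composes with `ε` to `g` by the axiom `base`.
  · obtain ⟨v, hv⟩ := hlift Y.alg (Y.d ≫ g.hom) (Y.isAlgMap.comp g)
    have hv' : ∀ (i : M.I) {A : C} (x : Y.alg.X.Point A),
        S.tauι i A ≫ e A (x ≫ v.hom) = Y.act i x ≫ g.hom := fun i A x => by
      rw [hv, ← Category.assoc]
      rfl
    refine ⟨EAlg.homMk v fun i A x => (e _).injective (S.tau_hom_ext fun j => ?_),
      IndAlg.hom_ext_points fun {A} x => ?_⟩
    · obtain ⟨l, f, hf⟩ := M.exists_isProd j i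
      refine (hv' j _).trans ?_
      refine Eq.trans ?_ (congrArg (S.tauι j _ ≫ ·) (hF i _).symm)
      rw [Y.isPointAction.prod f hf, Category.assoc, ← hv']
      exact (Category.assoc _ _ _).symm.trans
        ((congrArg (· ≫ e A (x ≫ v.hom)) (S.tauι_mulMap f hf A)).symm.trans (Category.assoc _ _ _))
    · obtain ⟨l, p, hp⟩ := M.exists_isBase
      change x ≫ v.hom ≫ ε.hom = _
      rw [← Category.assoc, hε, ← S.a_tauι p hp, Category.assoc, hv', ← Category.assoc,
        Y.isPointAction.base p hp]
  · obtain ⟨v, hv⟩ := hlift W s hs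
    refine ⟨v, fun i A x => (hact i _).trans (hv i x), fun v' hv' =>
      IndAlg.hom_ext_points fun {A} x => (e A).injective (S.tau_hom_ext fun i => ?_)⟩
    exact (hact i _).symm.trans ((hv' i x).trans (hv i x).symm)

/-- A free algebra with `E`-structure on `W` carries the universal algebra map out of `τ W`. -/
theorem IsCoherent.existsUnique_hom_of_free {S : EStructure M k C} (hS : S.IsCoherent)
    {W : IndAlg C} {Y : S.EAlg} (ε : W ⟶ Y.alg)
    (hY : ∀ (Z : S.EAlg) (f : W ⟶ Z.alg), ∃! h : Y ⟶ Z, ε ≫ h.hom = f)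
    (B : IndAlg C) (s : S.indTau.obj W.X ⟶ B.X) (hs : S.IsAlgMap W B s) :
    ∃! g : Y.alg ⟶ B, (S.indTau.map ε.hom ≫ Y.d) ≫ g.hom = s := by
  obtain ⟨F, π, hF, hπ⟩ := hS.exists_cofree B
  obtain ⟨v, hv, hvuniq⟩ := hπ W s hs
  obtain ⟨h, hh, hhuniq⟩ := hY F v
  have hpush : ∀ (q : Y ⟶ F) (i : M.I) {A : C} (x : W.X.Point A),
      F.act i (x ≫ (ε ≫ q.hom).hom) ≫ π.hom =
        S.push i x ≫ (S.indTau.map ε.hom ≫ Y.d) ≫ (q.hom ≫ π).hom := by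
    intro q i A x
    have h₁ := EAlg.act_comp_hom q i (x ≫ ε.hom)
    have h₂ : x ≫ (ε ≫ q.hom).hom = (x ≫ ε.hom) ≫ q.hom.hom := (Category.assoc _ _ _).symm
    have h₃ : (q.hom ≫ π).hom = q.hom.hom ≫ π.hom := rfl
    rw [h₂, ← h₁, h₃, EAlg.act, ← S.push_map]
    simp only [Category.assoc]
  refine ⟨h.hom ≫ π, S.indTau_hom_ext fun i A x => ?_, fun g hg => ?_⟩
  · rw [← hv, ← hh, hpush]
  -- Any competitor extends to `q : Y ⟶ F`; its restriction to `W` is forced to be `v`, and then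
  -- freeness of `Y` forces `q = h`.
  · obtain ⟨q, rfl⟩ := hF Y g
    have : ε ≫ q.hom = v := hvuniq _ fun i A x => by rw [hpush, hg]
    rw [hhuniq q this]

/-- Read in the opposite categories, the counit of the adjunction is the unit of the free
construction, so any right adjoint `R` supplies free algebras with `E`-structure. -/
theorem existsUnique_hom_of_adjunction (S : EStructure M k C) {R : (IndAlg C)ᵒᵖ ⥤ S.MSch}
    (adj : S.forgetSch ⊣ R) (W : IndAlg C) (Y : S.EAlg) (f : W ⟶ Y.alg) :
    ∃! h : (R.obj (op W)).unop ⟶ Y, (adj.counit.app (op W)).unop ≫ h.hom = f := by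
  have key : ∀ h : op Y ⟶ R.obj (op W),
      (adj.homEquiv (op Y) (op W)).symm h = ((adj.counit.app (op W)).unop ≫ h.unop.hom).op :=
    fun h => adj.homEquiv_counit _ _ h
  refine ⟨(adj.homEquiv (op Y) (op W) f.op).unop, Quiver.Hom.op_inj ((key _).symm.trans ?_),
    fun h hh => Quiver.Hom.op_inj ?_⟩
  · exact (adj.homEquiv (op Y) (op W)).symm_apply_apply f.op
  · exact (adj.homEquiv (op Y) (op W)).symm_apply_eq.1 ((key h.op).trans (congrArg _ hh))

end EStructure

end

/-! ### The proposition -/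

theorem mainTheorem9 {k₀ : Type w} [CommRing k₀] (M : FormalMonoid.{u} k₀)
    (k : Type w) [Field k] [Algebra k₀ k]
    (C : Type u) [SmallCategory C] [Abelian C] [Linear k C] [MonoidalCategory C]
    [MonoidalPreadditive C] [MonoidalLinear k C] [RigidCategory C] [SymmetricCategory C]
    (hC : IsTensorCat k C) (S : EStructure M k C) :
    -- the forgetful functor has a right adjoint
    S.forgetSch.IsLeftAdjoint ∧
    -- if `a`, `b` are coherent, it is the prolongation: the algebra of `R W` is universal for
    -- algebra maps out of `τ W`
    (S.IsCoherent → ∀ (R : (IndAlg C)ᵒᵖ ⥤ S.MSch) (adj : S.forgetSch ⊣ R) (W : IndAlg C)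
      (t : S.indTau.obj W.X ⟶ (R.obj (op W)).unop.alg.X),
      t = S.indTau.map (adj.counit.app (op W)).unop.hom ≫ (R.obj (op W)).unop.d →
      S.IsAlgMap W (R.obj (op W)).unop.alg t ∧
      ∀ (B : IndAlg C) (s : S.indTau.obj W.X ⟶ B.X), S.IsAlgMap W B s →
        ∃! g : (R.obj (op W)).unop.alg ⟶ B, t ≫ g.hom = s) ∧
    -- the affine spaces of `C` and their images, the affine space `M`-schemes
    (∀ X : C, ∃ (A : IndAlg C) (s : Ind.yoneda.obj (Xᘁ) ⟶ A.X),
      (∀ (B : IndAlg C) (f : Ind.yoneda.obj (Xᘁ) ⟶ B.X), ∃! g : A ⟶ B, s ≫ g.hom = f) ∧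
      ∀ (R : (IndAlg C)ᵒᵖ ⥤ S.MSch) (adj : S.forgetSch ⊣ R) (B : S.EAlg)
        (f : Ind.yoneda.obj (Xᘁ) ⟶ B.alg.X),
        ∃! g : (R.obj (op A)).unop ⟶ B,
          s ≫ (adj.counit.app (op A)).unop.hom ≫ g.hom.hom = f) := by
  refine ⟨inferInstance, fun hS R adj W t ht => ?_, fun V => ?_⟩
  · subst ht
    exact ⟨(R.obj (op W)).unop.isAlgMap.precomp _,
      hS.existsUnique_hom_of_free _ (S.existsUnique_hom_of_adjunction adj W)⟩
  · obtain ⟨A, s, hs⟩ := IndAlg.exists_free (Vᘁ)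
    refine ⟨A, s, hs, fun R adj B f => ?_⟩
    -- A morphism from the dual of `V` extends uniquely to an algebra map from `A`, which extends
    -- uniquely to a map preserving `E`-structures.
    obtain ⟨φ, hφ, hφuniq⟩ := hs B.alg f
    obtain ⟨g, hg, hguniq⟩ := S.existsUnique_hom_of_adjunction adj A B φ
    refine ⟨g, ?_, fun g' hg' => hguniq g' (hφuniq _ hg')⟩
    exact (congrArg (fun h : A ⟶ B.alg => s ≫ h.hom) hg).trans hφ
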